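/- **Setting.** Let $d\ge 2$ and let $\Omega\subset\mathbb R^d$ be a bounded Lipschitz domain with polyhedral boundary $\Gamma$, $\Gamma_D\subseteq\Gamma$ a non-empty closed subset, $f,g\in L^2(\Omega)$, $F(v)=\int_\Omega fv\,dx$ and $g(v):=\int_\Omega gv\,dx$. Let $\mathcal T_H$ be a mesh of $\Omega$ and $\mathcal T_h$ a refinement of it. Each is a regular subdivision into closed simplices, or into quadrilaterals/hexahedra with flat faces: the elements are $T=F_T(\hat T)$, where $\hat T$ is the unit simplex or the unit cube and $F_T$ is injective on $\hat T$ and affine, respectively multilinear; any two distinct elements meet in a common proper face of some dimension or not at all. Refinement means that the element maps of $\mathcal T_h$ are $F_T\circ S$ with $T\in\mathcal T_H$ and $S$ an affine map of $\hat T$ into itself (for cubes: onto a box with axis-parallel edges). Both meshes are shape regular with constant $\kappa$: $\kappa^{-1}\operatorname{diam}(T)|x-y|\le|F_T(x)-F_T(y)|\le\kappa\operatorname{diam}(T)|x-y|$ for $x,y\in\hat T$. $\Gamma_D$ is a union of $(d-1)$-dimensional faces of $\mathcal T_h$. Let $A$ be a measurable field of symmetric $d\times d$ matrices on $\Omega$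 with $\alpha|\xi|^2\le A(x)\xi\cdot\xi\le\beta|\xi|^2$ for a.e. $x$ and all $\xi$, where $0<\alpha\le\beta<\infty$, that extends continuously from the interior of each $T\in\mathcal T_h$ to $T$ (so that the traces below exist). Let $P_1(\mathcal T)$ be the space of functions $v$ such that, for each $T\in\mathcal T$, $v|_T\circ F_T$ is a polynomial of total degree $\le1$ (simplices), respectively of degree $\le 1$ in each variable (cubes), with no continuity between elements. Put $\mathcal V_h=P_1(\mathcal T_h)$, let $\nabla_h$ be the $\mathcal T_h$-piecewise gradient and let $\mathcal E$ be the set of those $(d-1)$-dimensional faces of $\mathcal T_h$ that are interior or contained in $\Gamma_D$. For $e\in\mathcal E$ let $h_e=\operatorname{diam}e$; for an interior face $e$ between $T^-$ and $T^+$ let $\nu$ be its unit normal pointing from $T^-$ to $T^+$, $[v]=v|_{T^-}-v|_{T^+}$ and $\{w\}=(w|_{T^-}+w|_{T^+})/2$; for a boundary face let $\nu$ be the outward normal, $[v]=v|_e$ and $\{w\}=w|_e$. For $\sigma>0$ set $$a_h(v,w)=(A\nabla_hv,\nabla_hw)_{L^2(\Omega)}-\sum_{e\in\mathcal E}\Big((\{\nu\cdot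 A\nabla v\},[w])_{L^2(e)}+(\{\nu\cdot A\nabla w\},[v])_{L^2(e)}-\tfrac{\sigma}{h_e}([v],[w])_{L^2(e)}\Big),$$ $$|||v|||_h^2=\|A^{1/2}\nabla_hv\|_{L^2(\Omega)}^2+\sum_{e\in\mathcal E}\tfrac{\sigma}{h_e}\|[v]\|_{L^2(e)}^2 .$$ Let $\Pi_H$ be the $L^2(\Omega)$-projection onto $P_1(\mathcal T_H)$ and $\mathcal V^{\rm f}=\{v\in\mathcal V_h:\Pi_Hv=0\}$. For $T\in\mathcal T_H$ let $\omega_T^1=\operatorname{int}T$ and $\omega_T^{L}=\operatorname{int}\bigcup\{T'\in\mathcal T_H:T'\cap\overline{\omega_T^{L-1}}\ne\emptyset\}$ for $L\ge2$, and let $\mathcal V^{\rm f}(\omega)=\{v\in\mathcal V^{\rm f}:v=0\text{ a.e. on }\Omega\setminus\omega\}$. Let $\lambda_{T,j}$ be the element-wise Lagrange basis functions of $P_1(\mathcal T_H)$ ($j$ runs over the vertices of $T$), let $\phi_{T,j}^L\in\mathcal V^{\rm f}(\omega_T^L)$ solve $a_h(\phi_{T,j}^L,w)=a_h(\lambda_{T,j},w)$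 for all $w\in\mathcal V^{\rm f}(\omega_T^L)$, and let $\mathcal V_H^{ms,L}=\operatorname{span}\{\lambda_{T,j}-\phi_{T,j}^L\}$. **Theorem.** For all $d\ge2$, each of the two kinds of meshes and every $\kappa$ there is a constant $C\ge 0$, and for all $0<\alpha\le\beta$ there is a $\sigma_0>0$ (depending only on $d$, the kind of mesh, $\kappa,\alpha,\beta$), such that in the above setting, with any penalty parameter $\sigma\ge\sigma_0$ and any integer $L\ge1$, the following holds. Let $u\in H^1_D(\Omega)=\{v\in H^1(\Omega): v|_{\Gamma_D}=0 \text{ in the sense of traces}\}$ satisfy $\int_\Omega A\nabla u\cdot\nabla v\,dx=F(v)$ for all $v\in H^1_D(\Omega)$; let $u_h\in\mathcal V_h$ satisfy $a_h(u_h,v)=F(v)$ for all $v\in\mathcal V_h$ and $u_H^{ms,L}\in\mathcal V_H^{ms,L}$ satisfy $a_h(u_H^{ms,L},v)=F(v)$ for all $v\in\mathcal V_H^{ms,L}$; let $\phi_h\in\mathcal V_h$ satisfy $a_h(v,\phi_h)=g(v)$ for all $v\in\mathcal V_h$ and $\phi_H^{ms,L}\in\mathcal V_H^{ms,L}$ satisfy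 $a_h(v,\phi_H^{ms,L})=g(v)$ for all $v\in\mathcal V_H^{ms,L}$. Then $$|g(u)-g(u_H^{ms,L})|\le|g(u)-g(u_h)|+C\,|||u_h-u_H^{ms,L}|||_h\,|||\phi_h-\phi_H^{ms,L}|||_h .$$ In particular, $C$ depends neither on the mesh sizes nor on $A$. -/

import Mathlib

open MeasureTheory Filter Topology Set

noncomputable section

namespace DGMultiscale

/-- The Euclidean space `ℝ^d`. -/
abbrev Eu (d : ℕ) : Type := EuclideanSpace ℝ (Fin d)

/-! ### Domains, Sobolev functions, the model problem -/

/-- Bounded Lipschitz domain with polygonal (polyhedral) boundary: near every boundary point,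
in suitable Cartesian coordinates, `Ω` is the strict hypograph of a Lipschitz function, and the
boundary is contained in finitely many hyperplanes. -/
structure IsPolyhedralLipschitzDomain {d : ℕ} (Ω : Set (Eu d)) : Prop where
  isOpen : IsOpen Ω
  isConnected : IsConnected Ω
  isBounded : Bornology.IsBounded Ω
  lipschitz : ∀ x₀ ∈ frontier Ω, ∃ (r : ℝ) (n : Eu d) (K : NNReal) (γ : Eu d → ℝ),
    0 < r ∧ ‖n‖ = 1 ∧ LipschitzWith K γ ∧
      ∀ y ∈ Metric.ball x₀ r, y ∈ Ω ↔ inner ℝ n y < γ (y - (inner ℝ n y : ℝ) • n)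
  polyhedral : ∃ S : Finset (Eu d × ℝ), (∀ p ∈ S, p.1 ≠ 0) ∧
    frontier Ω ⊆ ⋃ p ∈ S, {x | inner ℝ p.1 x = p.2}

/-- `G` is the weak gradient of `u` on the open set `Ω`. -/
def IsWeakGradient {d : ℕ} (Ω : Set (Eu d)) (u : Eu d → ℝ) (G : Eu d → Eu d) : Prop :=
  ∀ φ : Eu d → ℝ, ContDiff ℝ (⊤ : ℕ∞) φ → HasCompactSupport φ → tsupport φ ⊆ Ω →
    ∫ x in Ω, u x • gradient φ x = -∫ x in Ω, φ x • G x

/-- `u ∈ H¹(Ω)` with weak gradient `G`. -/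
structure MemH1 {d : ℕ} (Ω : Set (Eu d)) (u : Eu d → ℝ) (G : Eu d → Eu d) : Prop where
  memLp : MemLp u 2 (volume.restrict Ω)
  memLp_grad : MemLp G 2 (volume.restrict Ω)
  weakGrad : IsWeakGradient Ω u G

/-- `τ ∈ L²(∂Ω)` is the trace of `u ∈ H¹(Ω)` (with weak gradient `G`): the limit in `L²(∂Ω)` of
the restrictions to `∂Ω` of smooth functions that converge to `u` in `H¹(Ω)`. -/
def HasTrace {d : ℕ} (Ω : Set (Eu d)) (u : Eu d → ℝ) (G : Eu d → Eu d) (τ : Eu d → ℝ) : Prop :=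
  MemLp τ 2 ((μHE[d - 1]).restrict (frontier Ω)) ∧
  ∃ φ : ℕ → Eu d → ℝ, (∀ n, ContDiff ℝ (⊤ : ℕ∞) (φ n)) ∧
    Tendsto (fun n => eLpNorm (fun x => φ n x - u x) 2 (volume.restrict Ω)) atTop (𝓝 0) ∧
    Tendsto (fun n => eLpNorm (fun x => gradient (φ n) x - G x) 2 (volume.restrict Ω))
      atTop (𝓝 0) ∧
    Tendsto (fun n => eLpNorm (fun x => φ n x - τ x) 2 ((μHE[d - 1]).restrict (frontier Ω)))
      atTop (𝓝 0)

/-- `u ∈ H¹_D(Ω)`, with weak gradient `G`: the trace of `u` vanishes on `ΓD`. -/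
def MemH1D {d : ℕ} (Ω ΓD : Set (Eu d)) (u : Eu d → ℝ) (G : Eu d → Eu d) : Prop :=
  MemH1 Ω u G ∧ ∃ τ, HasTrace Ω u G τ ∧ ∀ᵐ x ∂((μHE[d - 1]).restrict ΓD), τ x = 0

/-- `u ∈ H¹_D(Ω)` and `∫_Ω A∇u·∇v = ∫_Ω f v` for all `v ∈ H¹_D(Ω)`. The coefficient is
a field of `d × d` matrices, regarded as linear maps of `ℝ^d`. -/
def IsWeakSolution {d : ℕ} (Ω ΓD : Set (Eu d)) (A : Eu d → Eu d →L[ℝ] Eu d) (f u : Eu d → ℝ) :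
    Prop :=
  ∃ G, MemH1D Ω ΓD u G ∧ ∀ v Gv, MemH1D Ω ΓD v Gv →
    ∫ x in Ω, inner ℝ (A x (G x)) (Gv x) = ∫ x in Ω, f x * v x

/-- The functional `v ↦ ∫_Ω g v` given by `g ∈ L²(Ω)`. -/
def functional {d : ℕ} (Ω : Set (Eu d)) (g v : Eu d → ℝ) : ℝ := ∫ x in Ω, g x * v x

/-! ### Reference elements -/

/-- The two kinds of meshes: simplicial, or quadrilateral / hexahedral. -/
inductive RefKind where
  | simplex
  | cube

/-- The reference simplex or the reference cube (closed). -/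
def refElem (d : ℕ) : RefKind → Set (Eu d)
  | .simplex => {x | (∀ i, 0 ≤ x i) ∧ ∑ i, x i ≤ 1}
  | .cube => {x | ∀ i, 0 ≤ x i ∧ x i ≤ 1}

/-- Labels of the `(d-1)`-dimensional faces of the reference element. -/
def FacetIdx (d : ℕ) : RefKind → Type
  | .simplex => Option (Fin d)
  | .cube => Fin d × Bool

instance (d : ℕ) : (K : RefKind) → Fintype (FacetIdx d K)
  | .simplex => inferInstanceAs (Fintype (Option (Fin d)))
  | .cube => inferInstanceAs (Fintype (Fin d × Bool))

/-- The (closed) `(d-1)`-dimensional faces of the reference element. -/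
def refFacet (d : ℕ) : (K : RefKind) → FacetIdx d K → Set (Eu d)
  | .simplex, none => {x ∈ refElem d .simplex | ∑ i, x i = 1}
  | .simplex, some i => {x ∈ refElem d .simplex | x i = 0}
  | .cube, (i, false) => {x ∈ refElem d .cube | x i = 0}
  | .cube, (i, true) => {x ∈ refElem d .cube | x i = 1}

/-- Labels of the vertices of the reference element: `d + 1` for the simplex (`none` is the
origin, `some i` the `i`-th unit vector), `2 ^ d` for the cube (`b` is the vertex with `i`-th
coordinate `1` if `b i`, and `0` otherwise). -/
def VertexIdx (d : ℕ) : RefKind → Type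
  | .simplex => Option (Fin d)
  | .cube => Fin d → Bool

/-- The Lagrange basis of the reference element associated with the vertices. -/
def refLagrange (d : ℕ) : (K : RefKind) → VertexIdx d K → Eu d → ℝ
  | .simplex, none => fun x => 1 - ∑ i, x i
  | .simplex, some i => fun x => x i
  | .cube, b => fun x => ∏ i, if (b : Fin d → Bool) i = true then x i else 1 - x i

/-- `𝓟_p` (total degree at most `p`) for simplices, `𝓠_p` (degree at most `p` in each variable)
for cubes. -/
def refPoly (d : ℕ) (K : RefKind) (p : ℕ) : Submodule ℝ (MvPolynomial (Fin d) ℝ) :=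
  match K with
  | .simplex => MvPolynomial.restrictTotalDegree (Fin d) ℝ p
  | .cube => MvPolynomial.restrictDegree (Fin d) ℝ p

/-- Evaluation of a polynomial at a point of `ℝ^d`. -/
def evalAt {d : ℕ} (x : Eu d) (q : MvPolynomial (Fin d) ℝ) : ℝ := MvPolynomial.eval (fun i => x i) q

/-! ### Meshes -/

/-- A regular subdivision of `Ω` into simplices, or into quadrilaterals / hexahedra, with its
element maps: affine maps of the reference simplex, multilinear maps of the reference cube. -/
structure Mesh {d : ℕ} (K : RefKind) (Ω : Set (Eu d)) where
  /-- number of elements -/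
  card : ℕ
  /-- the element maps -/
  map : Fin card → Eu d → Eu d
  map_poly : ∀ T i, ∃ q ∈ refPoly d K 1, ∀ x, map T x i = evalAt x q
  map_inj : ∀ T, InjOn (map T) (refElem d K)
  cover : closure Ω = ⋃ T, map T '' refElem d K
  subset : ∀ T, map T '' interior (refElem d K) ⊆ Ω
  /-- Two distinct elements meet in a common proper face of some dimension, possibly empty; the
  proper faces of the reference element are the intersections of facets. -/
  regular : ∀ T T', T ≠ T' → ∃ I J : Set (FacetIdx d K), I.Nonempty ∧ J.Nonempty ∧
    map T '' refElem d K ∩ map T' '' refElem d K = map T '' (⋂ k ∈ I, refFacet d K k) ∧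
    map T '' refElem d K ∩ map T' '' refElem d K = map T' '' (⋂ k ∈ J, refFacet d K k)
  /-- the element `T⁻` of a face -/
  minus : Set (Eu d) → Fin card
  /-- the element `T⁺` of an interior face -/
  plus : Set (Eu d) → Fin card
  /-- the unit normal of a face -/
  normal : Set (Eu d) → Eu d
  /-- Every face is a face of `T⁻`; it is flat, `normal` is its unit normal pointing out of `T⁻`,
  and `T⁻` lies on one side of it. -/
  minus_spec : ∀ T k, (∃ l, map (minus (map T '' refFacet d K k)) '' refFacet d K l =
      map T '' refFacet d K k) ∧ ‖normal (map T '' refFacet d K k)‖ = 1 ∧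
    ∀ x ∈ map T '' refFacet d K k, ∀ y ∈ map (minus (map T '' refFacet d K k)) '' refElem d K,
      inner ℝ (normal (map T '' refFacet d K k)) (y - x) ≤ 0
  /-- If two distinct elements share a face, then it is also a face of `T⁺ ≠ T⁻`, and `normal`
  points into `T⁺`. -/
  plus_spec : ∀ T k T' k', T ≠ T' → map T '' refFacet d K k = map T' '' refFacet d K k' →
    plus (map T '' refFacet d K k) ≠ minus (map T '' refFacet d K k) ∧
    (∃ l, map (plus (map T '' refFacet d K k)) '' refFacet d K l = map T '' refFacet d K k) ∧
    ∀ x ∈ map T '' refFacet d K k, ∀ y ∈ map (plus (map T '' refFacet d K k)) '' refElem d K,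
      0 ≤ inner ℝ (normal (map T '' refFacet d K k)) (y - x)

namespace Mesh

variable {d : ℕ} {K : RefKind} {Ω : Set (Eu d)} (M : Mesh K Ω)

/-- The closed element. -/
def elem (T : Fin M.card) : Set (Eu d) := M.map T '' refElem d K

/-- The open element. -/
def cell (T : Fin M.card) : Set (Eu d) := M.map T '' interior (refElem d K)

/-- The faces of an element, of dimension `d - 1`. -/
def facet (T : Fin M.card) (k : FacetIdx d K) : Set (Eu d) := M.map T '' refFacet d K k

open scoped Classical in
/-- The set `𝓔` of all faces of dimension `d - 1`. -/
def faces : Finset (Set (Eu d)) :=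
  Finset.univ.image fun p : Fin M.card × FacetIdx d K => M.facet p.1 p.2

/-- The face `e` is shared by two distinct elements. -/
def IsInterior (e : Set (Eu d)) : Prop :=
  ∃ T k T' k', T ≠ T' ∧ M.facet T k = e ∧ M.facet T' k' = e

open scoped Classical in
/-- `𝓔(Ω) ∪ 𝓔(Γ_D)`. -/
def dgFaces (ΓD : Set (Eu d)) : Finset (Set (Eu d)) :=
  M.faces.filter fun e => M.IsInterior e ∨ e ⊆ ΓD

/-- Shape regularity with constant `κ`: after scaling by the diameter, the element maps are
bi-Lipschitz with constant `κ`. -/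
def ShapeRegular (κ : ℝ) : Prop :=
  ∀ T, ∀ x ∈ refElem d K, ∀ y ∈ refElem d K,
    Metric.diam (M.elem T) * dist x y ≤ κ * dist (M.map T x) (M.map T y) ∧
    dist (M.map T x) (M.map T y) ≤ κ * Metric.diam (M.elem T) * dist x y

/-- The boundary part `ΓD` is resolved by the mesh: it is a union of faces. -/
def Resolves (ΓD : Set (Eu d)) : Prop :=
  ∃ S : Finset (Set (Eu d)), S ⊆ M.faces ∧ ΓD = ⋃ e ∈ S, e

/-- Piecewise polynomials `P_p(𝓣)`. Such a function may jump across faces; its values on the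
union of the faces (a null set) are immaterial. -/
def space (p : ℕ) : Submodule ℝ (Eu d → ℝ) where
  carrier := {v | ∀ T, ∃ q ∈ refPoly d K p, ∀ x ∈ interior (refElem d K),
    v (M.map T x) = evalAt x q}
  zero_mem' := fun _ => ⟨0, Submodule.zero_mem _, fun x _ => by simp [evalAt]⟩
  add_mem' := by
    intro v w hv hw T
    obtain ⟨q, hq, h⟩ := hv T
    obtain ⟨q', hq', h'⟩ := hw T
    exact ⟨q + q', Submodule.add_mem _ hq hq', fun x hx => by
      simp only [Pi.add_apply, h x hx, h' x hx, evalAt, map_add]⟩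
  smul_mem' := by
    intro c v hv T
    obtain ⟨q, hq, h⟩ := hv T
    exact ⟨c • q, Submodule.smul_mem _ c hq, fun x hx => by
      simp only [Pi.smul_apply, h x hx, evalAt, MvPolynomial.smul_eval, smul_eq_mul]⟩

open scoped Classical in
/-- The piecewise gradient `∇_𝓣 v` (set to zero on the union of the faces). -/
def brokenGrad (v : Eu d → ℝ) (x : Eu d) : Eu d :=
  if x ∈ ⋃ T, M.cell T then gradient v x else 0

/-- The trace on the closed element `T` of a function given on its interior: its limit from
inside `T`. -/
def traceFrom {X : Type} [TopologicalSpace X] (T : Fin M.card) (w : Eu d → X) : Eu d → X :=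
  extendFrom (M.cell T) w

open scoped Classical in
/-- The jump `[v]` across the face `e`. -/
def jump (v : Eu d → ℝ) (e : Set (Eu d)) (x : Eu d) : ℝ :=
  if M.IsInterior e then M.traceFrom (M.minus e) v x - M.traceFrom (M.plus e) v x
  else M.traceFrom (M.minus e) v x

open scoped Classical in
/-- The average `{ν · A∇v}` on the face `e`. -/
def avgFlux (A : Eu d → Eu d →L[ℝ] Eu d) (v : Eu d → ℝ) (e : Set (Eu d)) (x : Eu d) : ℝ :=
  if M.IsInterior e then
    (inner ℝ (M.normal e) (M.traceFrom (M.minus e) (fun y => A y (M.brokenGrad v y)) x) +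
      inner ℝ (M.normal e) (M.traceFrom (M.plus e) (fun y => A y (M.brokenGrad v y)) x)) / 2
  else inner ℝ (M.normal e) (M.traceFrom (M.minus e) (fun y => A y (M.brokenGrad v y)) x)

/-- The diffusion coefficient is symmetric with spectral bounds `α, β` almost everywhere in `Ω`.
So that `A∇v` has traces on the faces for piecewise polynomial `v`, it extends continuously from
the interior of each element of the mesh to the closed element. -/
structure IsDiffusion (A : Eu d → Eu d →L[ℝ] Eu d) (α β : ℝ) : Prop where
  aestronglyMeasurable : AEStronglyMeasurable A (volume.restrict Ω)
  symm : ∀ᵐ x ∂(volume.restrict Ω), ∀ v w, inner ℝ (A x v) w = inner ℝ v (A x w)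
  bounds : ∀ᵐ x ∂(volume.restrict Ω), ∀ v,
    α * ‖v‖ ^ 2 ≤ inner ℝ (A x v) v ∧ inner ℝ (A x v) v ≤ β * ‖v‖ ^ 2
  piecewise : ∀ T, ∃ B : Eu d → Eu d →L[ℝ] Eu d, ContinuousOn B (M.elem T) ∧ EqOn A B (M.cell T)

/-- The symmetric interior penalty form `a_h` with penalty parameter `σ`. -/
def form (ΓD : Set (Eu d)) (A : Eu d → Eu d →L[ℝ] Eu d) (σ : ℝ) (u v : Eu d → ℝ) : ℝ :=
  (∫ x in Ω, inner ℝ (A x (M.brokenGrad u x)) (M.brokenGrad v x)) -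
    ∑ e ∈ M.dgFaces ΓD,
      ((∫ x in e, M.avgFlux A u e x * M.jump v e x ∂μHE[d - 1]) +
        (∫ x in e, M.avgFlux A v e x * M.jump u e x ∂μHE[d - 1]) -
        σ / Metric.diam e * ∫ x in e, M.jump u e x * M.jump v e x ∂μHE[d - 1])

/-- The energy norm
`(‖A^{1/2} ∇_h v‖²_{L²(Ω)} + ∑_e σ / h_e ‖[v]‖²_{L²(e)})^{1/2}`; note `|A^{1/2} ξ|² = Aξ·ξ`. -/
def energyNorm (ΓD : Set (Eu d)) (A : Eu d → Eu d →L[ℝ] Eu d) (σ : ℝ) (v : Eu d → ℝ) : ℝ :=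
  Real.sqrt ((∫ x in Ω, inner ℝ (A x (M.brokenGrad v x)) (M.brokenGrad v x)) +
    ∑ e ∈ M.dgFaces ΓD, σ / Metric.diam e * ∫ x in e, M.jump v e x ^ 2 ∂μHE[d - 1])

/-- `w` is the `L²(Ω)`-projection `Π_p(𝓣) v` of `v` onto the piecewise polynomials. -/
def IsL2Projection (p : ℕ) (v w : Eu d → ℝ) : Prop :=
  w ∈ M.space p ∧ ∀ z ∈ M.space p, ∫ x in Ω, (v x - w x) * z x = 0

open scoped Classical in
/-- The element-wise Lagrange basis function `λ_{T,j}`, supported on `T`. -/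
def lagrange (T : Fin M.card) (j : VertexIdx d K) (x : Eu d) : ℝ :=
  if x ∈ M.cell T then refLagrange d K j (Function.invFunOn (M.map T) (refElem d K) x) else 0

/-- The element patches `ω_T^L`, `L ≥ 1` (the value at `L = 0` is not used). -/
def patch (T : Fin M.card) : ℕ → Set (Eu d)
  | 0 => ∅
  | 1 => interior (M.elem T)
  | L + 2 => interior (⋃ T' ∈ {T' | (M.elem T' ∩ closure (patch T (L + 1))).Nonempty}, M.elem T')

/-- `Mh` is a refinement of `M`: the map of every fine element is the map of a coarse element
composed with an affine map of the reference element into itself, which for cubes takes boxes with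
axis-parallel edges to boxes with axis-parallel edges. -/
def IsRefinedBy (Mh : Mesh K Ω) : Prop :=
  ∀ t, ∃ T, ∃ S : Eu d →ᵃ[ℝ] Eu d, MapsTo S (refElem d K) (refElem d K) ∧
    (K = .cube → ∃ π : Equiv.Perm (Fin d), ∀ i, ∃ a b : ℝ, ∀ x, S x i = a + b * x (π i)) ∧
    ∀ x ∈ refElem d K, Mh.map t x = M.map T (S x)

end Mesh

/-! ### The multiscale method -/

section Multiscale

variable {d : ℕ} {K : RefKind} {Ω : Set (Eu d)}

/-- The fine scale space `𝓥^f = {v ∈ 𝓥_h : Π_H v = 0}`. -/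
def fineSpace (MH Mh : Mesh K Ω) : Set (Eu d → ℝ) :=
  {v | v ∈ Mh.space 1 ∧ MH.IsL2Projection 1 v 0}

/-- `𝓥^f(U) = {v ∈ 𝓥^f : v = 0 on Ω \ U}`. -/
def fineSpaceOn (MH Mh : Mesh K Ω) (U : Set (Eu d)) : Set (Eu d → ℝ) :=
  {v | v ∈ fineSpace MH Mh ∧ ∀ᵐ x ∂(volume.restrict (Ω \ U)), v x = 0}

/-- `φ T j` are the localized correctors `φ_{T,j}^L`. -/
def AreCorrectors (MH Mh : Mesh K Ω) (ΓD : Set (Eu d)) (A : Eu d → Eu d →L[ℝ] Eu d) (σ : ℝ)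
    (L : ℕ) (φ : Fin MH.card → VertexIdx d K → Eu d → ℝ) : Prop :=
  ∀ T j, φ T j ∈ fineSpaceOn MH Mh (MH.patch T L) ∧
    ∀ w ∈ fineSpaceOn MH Mh (MH.patch T L),
      Mh.form ΓD A σ (φ T j) w = Mh.form ΓD A σ (MH.lagrange T j) w

/-- The multiscale space `𝓥_H^{ms,L}`, spanned by the `λ_{T,j} - φ_{T,j}^L`. -/
def msSpace (MH : Mesh K Ω) (φ : Fin MH.card → VertexIdx d K → Eu d → ℝ) :
    Submodule ℝ (Eu d → ℝ) :=
  Submodule.span ℝ (Set.range fun p : Fin MH.card × VertexIdx d K =>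
    MH.lagrange p.1 p.2 - φ p.1 p.2)

/-- `u ∈ V` solves the (primal) Galerkin problem `a_h(u, v) = ∫_Ω f v` for all `v ∈ V`. -/
def IsGalerkin (Mh : Mesh K Ω) (ΓD : Set (Eu d)) (A : Eu d → Eu d →L[ℝ] Eu d) (σ : ℝ)
    (f : Eu d → ℝ) (V : Submodule ℝ (Eu d → ℝ)) (u : Eu d → ℝ) : Prop :=
  u ∈ V ∧ ∀ v ∈ V, Mh.form ΓD A σ u v = functional Ω f v

/-- `φ ∈ V` solves the dual Galerkin problem `a_h(v, φ) = g(v)` for all `v ∈ V`. -/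
def IsDualGalerkin (Mh : Mesh K Ω) (ΓD : Set (Eu d)) (A : Eu d → Eu d →L[ℝ] Eu d) (σ : ℝ)
    (g : Eu d → ℝ) (V : Submodule ℝ (Eu d → ℝ)) (φ : Eu d → ℝ) : Prop :=
  φ ∈ V ∧ ∀ v ∈ V, Mh.form ΓD A σ v φ = functional Ω g v

end Multiscale

end DGMultiscale

end

open MeasureTheory Filter Topology Set

noncomputable section

namespace DGMultiscale

/-! ### Bi-Lipschitz smooth maps -/

/-! Split `g(u) - g(u_H)` at `u_h`; it remains to bound `g(u_h - u_H)`. The dual problem turns this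
into `a_h(u_h - u_H, φ_h)`. The multiscale space lies in `𝓥_h` (`msSpace_le`), so Galerkin
orthogonality allows `φ_H` to be subtracted in the second slot (`functional_sub_eq_form`), and the
estimate reduces to boundedness of `a_h` in the energy norm (`exists_abs_form_le`). Neither
coercivity nor decay of the correctors plays a role.

Boundedness with a constant independent of `A` and of the mesh sizes is the actual work. The volume
and penalty terms are Cauchy–Schwarz. For the flux terms, the discrete trace inequality
`exists_trace_inequality` bounds `h_T ‖∇v‖²` on a facet by `‖∇v‖²` on the element. Since `|A∇v| ≤
β|∇v|`, the flux paired with a jump costs a factor `β² / σ` in front of `‖∇v‖²`. For `σ ≥ β² / α`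
this is at most `α`, and `α|∇v|² ≤ A∇v·∇v` absorbs it into the energy.

The trace inequality is a scaling argument. On the reference element the derivatives of polynomials
form a finite-dimensional space, where the sup norm is controlled by the `L²` norm. The bi-Lipschitz
bounds on the element maps carry this to each element; they replace the change of variables formula,
so no Jacobian determinants appear. -/

theorem injOn_of_antilipschitz {X Y : Type*} [MetricSpace X] [MetricSpace Y] {s : Set X} {F : X → Y}
    {a : ℝ} (ha : 0 < a)
    (hlow : ∀ x ∈ s, ∀ y ∈ s, a * dist x y ≤ dist (F x) (F y)) : InjOn F s := by
  intro x hx y hy hxy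
  have h := hlow x hx y hy
  rw [hxy, dist_self] at h
  exact dist_le_zero.1 (by nlinarith [dist_nonneg (x := x) (y := y)])

theorem lipschitzOnWith_invFunOn {X Y : Type*} [MetricSpace X] [Nonempty X] [MetricSpace Y]
    {s : Set X} {F : X → Y}
    {a : ℝ} (ha : 0 < a)
    (hlow : ∀ x ∈ s, ∀ y ∈ s, a * dist x y ≤ dist (F x) (F y)) :
    LipschitzOnWith (Real.toNNReal a⁻¹) (Function.invFunOn F s) (F '' s) := by
  refine LipschitzOnWith.of_dist_le_mul fun y hy z hz => ?_
  have h := hlow _ (Function.invFunOn_mem hy) _ (Function.invFunOn_mem hz)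
  rw [Function.invFunOn_eq hy, Function.invFunOn_eq hz] at h
  rw [Real.coe_toNNReal _ (inv_nonneg.2 ha.le), inv_mul_eq_div, le_div_iff₀' ha]
  exact h

section ElementMap

variable {E : Type*} [NormedAddCommGroup E] [InnerProductSpace ℝ E]
  {s : Set E} {F : E → E} {a b : ℝ}

/-- At interior points the lower bound holds for the difference quotients and passes to the limit.
It extends to the rest of `s` because the derivative is continuous and the interior is dense in `s`;
facets consist of such boundary points. -/
theorem le_norm_fderiv_of_antilipschitz (hs : s ⊆ closure (interior s)) (hF : ContDiff ℝ 1 F)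
    (hlow : ∀ x ∈ s, ∀ y ∈ s, a * dist x y ≤ dist (F x) (F y)) {x : E} (hx : x ∈ s) (ξ : E) :
    a * ‖ξ‖ ≤ ‖fderiv ℝ F x ξ‖ := by
  have hclosed : IsClosed {x | a * ‖ξ‖ ≤ ‖fderiv ℝ F x ξ‖} := by
    refine isClosed_le continuous_const ?_
    exact ((hF.continuous_fderiv one_ne_zero).clm_apply continuous_const).norm
  refine closure_minimal ?_ hclosed (hs hx)
  intro z hz
  have hd : HasFDerivAt F (fderiv ℝ F z) z := (hF.differentiable one_ne_zero z).hasFDerivAt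
  have hline : HasDerivAt (fun t : ℝ => F (z + t • ξ)) (fderiv ℝ F z ξ) 0 := hd.hasLineDerivAt ξ
  have hlim := hline.tendsto_slope_zero.norm
  simp only [zero_add, zero_smul, add_zero] at hlim
  refine ge_of_tendsto hlim ?_
  have hcont : Tendsto (fun t : ℝ => z + t • ξ) (𝓝[≠] 0) (𝓝 z) := by
    have : Tendsto (fun t : ℝ => z + t • ξ) (𝓝 0) (𝓝 (z + (0 : ℝ) • ξ)) :=
      Continuous.tendsto (by fun_prop) _
    simpa using this.mono_left nhdsWithin_le_nhds
  filter_upwards [hcont.eventually (mem_interior_iff_mem_nhds.1 hz), self_mem_nhdsWithin]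
    with t ht ht0
  have h := hlow (z + t • ξ) ht z (interior_subset hz)
  rw [dist_eq_norm, dist_eq_norm, add_sub_cancel_left, norm_smul] at h
  have ht0 : 0 < ‖t‖ := norm_pos_iff.2 ht0
  rw [norm_smul, norm_inv, inv_mul_eq_div, le_div_iff₀ ht0]
  linarith

variable [FiniteDimensional ℝ E]

theorem isInvertible_fderiv (ha : 0 < a) (hs : s ⊆ closure (interior s)) (hF : ContDiff ℝ 1 F)
    (hlow : ∀ x ∈ s, ∀ y ∈ s, a * dist x y ≤ dist (F x) (F y)) {x : E} (hx : x ∈ s) :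
    (fderiv ℝ F x).IsInvertible := by
  have hinj : Function.Injective (fderiv ℝ F x : E →ₗ[ℝ] E) := by
    rw [← LinearMap.ker_eq_bot, LinearMap.ker_eq_bot']
    intro ξ hξ
    have h := le_norm_fderiv_of_antilipschitz hs hF hlow hx ξ
    rw [ContinuousLinearMap.coe_coe] at hξ
    rw [hξ, norm_zero] at h
    have : ‖ξ‖ ≤ 0 := by nlinarith [norm_nonneg ξ]
    simpa using this
  refine ⟨(LinearEquiv.ofInjectiveEndo _ hinj).toContinuousLinearEquiv, ?_⟩
  ext ξ
  simp

theorem norm_inverse_fderiv_le (ha : 0 < a) (hs : s ⊆ closure (interior s)) (hF : ContDiff ℝ 1 F)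
    (hlow : ∀ x ∈ s, ∀ y ∈ s, a * dist x y ≤ dist (F x) (F y)) {x : E} (hx : x ∈ s) :
    ‖(fderiv ℝ F x).inverse‖ ≤ a⁻¹ := by
  obtain ⟨e, he⟩ := isInvertible_fderiv ha hs hF hlow hx
  refine ContinuousLinearMap.opNorm_le_bound _ (inv_nonneg.2 ha.le) fun ξ => ?_
  rw [← he, ContinuousLinearMap.inverse_equiv]
  have h := le_norm_fderiv_of_antilipschitz hs hF hlow hx (e.symm ξ)
  rw [← he] at h
  simp only [ContinuousLinearEquiv.coe_coe, ContinuousLinearEquiv.apply_symm_apply] at h ⊢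
  rwa [inv_mul_eq_div, le_div_iff₀' ha]

/-- The inverse function theorem, applied at points where the derivative is invertible. -/
theorem map_nhds_of_antilipschitz (ha : 0 < a) (hs : s ⊆ closure (interior s))
    (hF : ContDiff ℝ 1 F) (hlow : ∀ x ∈ s, ∀ y ∈ s, a * dist x y ≤ dist (F x) (F y))
    {x : E} (hx : x ∈ s) : map F (𝓝 x) = 𝓝 (F x) := by
  obtain ⟨e, he⟩ := isInvertible_fderiv ha hs hF hlow hx
  have h : HasStrictFDerivAt F (fderiv ℝ F x) x := hF.contDiffAt.hasStrictFDerivAt one_ne_zero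
  rw [← he] at h
  exact h.map_nhds_eq_of_equiv

theorem isOpen_image_interior (ha : 0 < a) (hs : s ⊆ closure (interior s)) (hF : ContDiff ℝ 1 F)
    (hlow : ∀ x ∈ s, ∀ y ∈ s, a * dist x y ≤ dist (F x) (F y)) : IsOpen (F '' interior s) := by
  rw [isOpen_iff_mem_nhds]
  rintro _ ⟨x, hx, rfl⟩
  rw [← map_nhds_of_antilipschitz ha hs hF hlow (interior_subset hx)]
  exact image_mem_map (isOpen_interior.mem_nhds hx)

/-- The derivative of `q ∘ F⁻¹`, extended to the closed image. -/
def pulledDeriv (F : E → E) (s : Set E) (q : E → ℝ) (y : E) : E →L[ℝ] ℝ :=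
  (fderiv ℝ q (Function.invFunOn F s y)).comp (fderiv ℝ F (Function.invFunOn F s y)).inverse

variable {q : E → ℝ}

/-- Continuity holds up to the boundary of the image: `F⁻¹` is Lipschitz on it, and inversion of
operators is continuous at invertible ones. Traces of gradients exist for this reason. -/
theorem continuousOn_pulledDeriv (ha : 0 < a) (hs : s ⊆ closure (interior s))
    (hF : ContDiff ℝ 1 F) (hlow : ∀ x ∈ s, ∀ y ∈ s, a * dist x y ≤ dist (F x) (F y))
    (hq : ContDiff ℝ 1 q) : ContinuousOn (pulledDeriv F s q) (F '' s) := by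
  have hcont := (lipschitzOnWith_invFunOn ha hlow).continuousOn
  refine ContinuousOn.clm_comp ?_ ?_
  · exact (hq.continuous_fderiv one_ne_zero).comp_continuousOn hcont
  · intro y hy
    have hinv := isInvertible_fderiv ha hs hF hlow (Function.invFunOn_mem hy)
    have hfd := (hF.continuous_fderiv one_ne_zero).continuousAt.comp_continuousWithinAt
      (f := Function.invFunOn F s) (hcont y hy)
    exact ContinuousAt.comp_continuousWithinAt (f := fun z => fderiv ℝ F (Function.invFunOn F s z))
      (hinv.contDiffAt_map_inverse (n := 0)).continuousAt hfd

theorem hasFDerivAt_of_comp_eq (ha : 0 < a) (hs : s ⊆ closure (interior s))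
    (hF : ContDiff ℝ 1 F) (hlow : ∀ x ∈ s, ∀ y ∈ s, a * dist x y ≤ dist (F x) (F y))
    (hq : ContDiff ℝ 1 q) {v : E → ℝ} (hv : ∀ x ∈ interior s, v (F x) = q x) {y : E}
    (hy : y ∈ F '' interior s) : HasFDerivAt v (pulledDeriv F s q y) y := by
  have hopen := isOpen_image_interior ha hs hF hlow
  have hinj := injOn_of_antilipschitz ha hlow
  have hsub : F '' interior s ⊆ F '' s := image_mono interior_subset
  obtain ⟨e, he⟩ := isInvertible_fderiv ha hs hF hlow (Function.invFunOn_mem (hsub hy))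
  have hinv : HasFDerivAt (Function.invFunOn F s) (e.symm : E →L[ℝ] E) y := by
    refine HasFDerivAt.of_local_left_inverse (f := F) ?_ ?_ ?_
    · exact (lipschitzOnWith_invFunOn ha hlow).continuousOn.continuousAt
        (mem_of_superset (hopen.mem_nhds hy) hsub)
    · rw [he]
      exact (hF.differentiable one_ne_zero _).hasFDerivAt
    · filter_upwards [hopen.mem_nhds hy] with z hz
      exact Function.invFunOn_eq (hsub hz)
  have hcomp := (hq.differentiable one_ne_zero (Function.invFunOn F s y)).hasFDerivAt.comp y hinv
  have heq : pulledDeriv F s q y =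
      (fderiv ℝ q (Function.invFunOn F s y)).comp (e.symm : E →L[ℝ] E) := by
    rw [pulledDeriv, ← he, ContinuousLinearMap.inverse_equiv]
  rw [heq]
  refine hcomp.congr_of_eventuallyEq ?_
  filter_upwards [hopen.mem_nhds hy] with z hz
  obtain ⟨x, hx, rfl⟩ := hz
  rw [hv x hx, Function.comp_apply, hinj.leftInvOn_invFunOn (interior_subset hx)]

theorem norm_pulledDeriv_le (ha : 0 < a) (hs : s ⊆ closure (interior s)) (hF : ContDiff ℝ 1 F)
    (hlow : ∀ x ∈ s, ∀ y ∈ s, a * dist x y ≤ dist (F x) (F y)) {y : E} (hy : y ∈ F '' s) :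
    ‖pulledDeriv F s q y‖ ≤ ‖fderiv ℝ q (Function.invFunOn F s y)‖ * a⁻¹ := by
  refine (ContinuousLinearMap.opNorm_comp_le _ _).trans ?_
  gcongr
  exact norm_inverse_fderiv_le ha hs hF hlow (Function.invFunOn_mem hy)

/-- By the chain rule the derivative of `q` is the pulled derivative composed with that of `F`,
whose norm is at most the Lipschitz constant `b`. -/
theorem norm_fderiv_le_norm_pulledDeriv (ha : 0 < a) (hs : s ⊆ closure (interior s))
    (hF : ContDiff ℝ 1 F) (hlow : ∀ x ∈ s, ∀ y ∈ s, a * dist x y ≤ dist (F x) (F y)) (hb : 0 ≤ b)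
    (hup : ∀ x ∈ s, ∀ y ∈ s, dist (F x) (F y) ≤ b * dist x y) {x : E} (hx : x ∈ interior s) :
    ‖fderiv ℝ q x‖ ≤ b * ‖pulledDeriv F s q (F x)‖ := by
  have hlip : LipschitzOnWith (Real.toNNReal b) F s := LipschitzOnWith.of_dist_le_mul
    fun y hy z hz => by rw [Real.coe_toNNReal _ hb]; exact hup y hy z hz
  have hbd := HasFDerivAt.le_of_lipschitzOn (hF.differentiable one_ne_zero x).hasFDerivAt
    (mem_interior_iff_mem_nhds.1 hx) hlip
  rw [Real.coe_toNNReal _ hb] at hbd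
  obtain ⟨e, he⟩ := isInvertible_fderiv ha hs hF hlow (interior_subset hx)
  have heq : fderiv ℝ q x = (pulledDeriv F s q (F x)).comp (fderiv ℝ F x) := by
    rw [pulledDeriv, (injOn_of_antilipschitz ha hlow).leftInvOn_invFunOn (interior_subset hx),
      ← he, ContinuousLinearMap.inverse_equiv]
    ext ξ
    simp
  calc ‖fderiv ℝ q x‖ ≤ ‖pulledDeriv F s q (F x)‖ * ‖fderiv ℝ F x‖ := by
        conv_lhs => rw [heq]
        exact ContinuousLinearMap.opNorm_comp_le _ _
    _ ≤ ‖pulledDeriv F s q (F x)‖ * b := by gcongr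
    _ = _ := mul_comm _ _

end ElementMap

/-! ### Measure estimates -/

theorem euclideanHausdorffMeasure_image_le {X Y : Type*} [MetricSpace X] [MeasurableSpace X]
    [BorelSpace X] [MetricSpace Y] [MeasurableSpace Y] [BorelSpace Y] {f : X → Y} {s : Set X}
    {C : NNReal} (h : LipschitzOnWith C f s) (m : ℕ) :
    μHE[m] (f '' s) ≤ (C : ENNReal) ^ m * μHE[m] s := by
  have := h.hausdorffMeasure_image_le (d := m) (Nat.cast_nonneg m)
  simp only [Measure.euclideanHausdorffMeasure_def, Measure.smul_apply]
  rw [ENNReal.rpow_natCast] at this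
  rw [mul_smul_comm]
  exact smul_le_smul_of_nonneg_left this (zero_le)

/-- The inverse of `F` is `a⁻¹`-Lipschitz and hence enlarges `d`-dimensional Hausdorff measure,
which is the volume, by at most `a⁻¹ ^ d`. -/
theorem volume_restrict_map_le {d : ℕ} {s : Set (Eu d)} {F : Eu d → Eu d} {a : ℝ} (ha : 0 < a)
    (hF : Measurable F)
    (hlow : ∀ x ∈ s, ∀ y ∈ s, a * dist x y ≤ dist (F x) (F y)) :
    (volume.restrict s).map F ≤ ENNReal.ofReal (a⁻¹ ^ d) • volume.restrict (F '' s) := by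
  refine Measure.le_iff.2 fun B hB => ?_
  rw [Measure.map_apply hF hB, Measure.restrict_apply (hF hB), Measure.smul_apply,
    Measure.restrict_apply hB, smul_eq_mul]
  have hlip : LipschitzOnWith (Real.toNNReal a⁻¹) (Function.invFunOn F s) (B ∩ F '' s) :=
    (lipschitzOnWith_invFunOn ha hlow).mono inter_subset_right
  have himage : Function.invFunOn F s '' (B ∩ F '' s) = F ⁻¹' B ∩ s := by
    have hleft := (injOn_of_antilipschitz ha hlow).leftInvOn_invFunOn
    ext x
    constructor
    · rintro ⟨_, ⟨hB, z, hz, rfl⟩, rfl⟩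
      rw [hleft hz]
      exact ⟨hB, hz⟩
    · rintro ⟨hxB, hx⟩
      exact ⟨F x, ⟨hxB, x, hx, rfl⟩, hleft hx⟩
  have h := euclideanHausdorffMeasure_image_le hlip d
  rw [himage, EuclideanSpace.euclideanHausdorffMeasure_eq_volume] at h
  rwa [ENNReal.ofReal_pow (inv_nonneg.2 ha.le)]

/-- A translation identifies `S` isometrically with a bounded subset of the orthogonal complement of
`n`, a Euclidean space of dimension `d - 1` in which `μHE[d - 1]` is the volume. -/
theorem euclideanHausdorffMeasure_hyperplane_lt_top {d : ℕ} {S : Set (Eu d)}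
    (hS : Bornology.IsBounded S) {n : Eu d} (hn : n ≠ 0) {c : ℝ}
    (h : ∀ x ∈ S, inner ℝ n x = c) : μHE[d - 1] S < ⊤ := by
  rcases S.eq_empty_or_nonempty with rfl | ⟨p, hp⟩
  · simp
  let V : Submodule ℝ (Eu d) := (ℝ ∙ n)ᗮ
  have hrank : Module.finrank ℝ V = d - 1 := by
    have h1 := Submodule.finrank_add_finrank_orthogonal (ℝ ∙ n)
    rw [finrank_span_singleton hn, finrank_euclideanSpace_fin] at h1
    change Module.finrank ℝ (ℝ ∙ n)ᗮ = _
    omega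
  let ι : V → Eu d := fun w => p + w
  have hι : Isometry ι := fun x y => by
    simp only [ι, edist_add_left]
    rfl
  have himage : ι '' (ι ⁻¹' S) = S := by
    refine image_preimage_eq_of_subset fun x hx => ?_
    refine ⟨⟨x - p, ?_⟩, by simp [ι]⟩
    rw [Submodule.mem_orthogonal_singleton_iff_inner_right, inner_sub_right, h x hx, h p hp,
      sub_self]
  have hb : Bornology.IsBounded (ι ⁻¹' S) := hι.antilipschitz.isBounded_preimage hS
  rw [← himage, hι.euclideanHausdorffMeasure_image, ← hrank]
  exact hb.measure_lt_top

/-! ### Inverse estimate on finite-dimensional spaces of continuous functions -/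

theorem isOpenPosMeasure_comap_subtype {E : Type*} [TopologicalSpace E] [MeasurableSpace E]
    [BorelSpace E] {μ : Measure E} [μ.IsOpenPosMeasure] {s : Set E} (hs : MeasurableSet s)
    (hcl : s ⊆ closure (interior s)) :
    (μ.comap (Subtype.val : s → E)).IsOpenPosMeasure := by
  refine ⟨fun U hU ⟨x, hx⟩ h0 => ?_⟩
  obtain ⟨V, hV, rfl⟩ := isOpen_induced_iff.1 hU
  rw [comap_subtype_coe_apply hs, Subtype.image_preimage_coe] at h0
  obtain ⟨y, hyV, hys⟩ := mem_closure_iff.1 (hcl x.2) V hV hx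
  refine ((hV.inter isOpen_interior).measure_pos μ ⟨y, hyV, hys⟩).ne' (measure_mono_null ?_ h0)
  exact fun z hz => ⟨interior_subset hz.2, hz.1⟩

/-- Equivalence of norms in finite dimension: the integral is continuous on the compact unit sphere
of `W` and positive there, because a nonzero continuous function has positive integral against a
measure charging open sets. The inverse of the minimum serves as `C`, by homogeneity. -/
theorem exists_norm_sq_le_setIntegral {E G : Type*} [MetricSpace E] [MeasurableSpace E]
    [BorelSpace E] [NormedAddCommGroup G] [NormedSpace ℝ G]
    {μ : Measure E} [μ.IsOpenPosMeasure] [IsLocallyFiniteMeasure μ] {s : Set E} [CompactSpace s]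
    (hcl : s ⊆ closure (interior s)) (W : Submodule ℝ C(s, G)) [FiniteDimensional ℝ W] :
    ∃ C : ℝ, 0 ≤ C ∧ ∀ f ∈ W, ‖f‖ ^ 2 ≤ C * ∫ x : s, ‖f x‖ ^ 2 ∂(μ.comap Subtype.val) := by
  have hs : IsCompact s := isCompact_iff_compactSpace.2 inferInstance
  set ν := μ.comap (Subtype.val : s → E) with hν
  have : ν.IsOpenPosMeasure := isOpenPosMeasure_comap_subtype hs.measurableSet hcl
  have : IsFiniteMeasure ν := ⟨by
    rw [hν, comap_subtype_coe_apply hs.measurableSet]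
    simpa using hs.measure_lt_top⟩
  have : ProperSpace W := FiniteDimensional.proper ℝ W
  have hcont : Continuous fun f : W => ∫ x, ‖(f : C(s, G)) x‖ ^ 2 ∂ν := by
    have huncurry : Continuous (Function.uncurry fun (f : W) (x : s) => ‖(f : C(s, G)) x‖ ^ 2) := by
      refine (Continuous.norm ?_).pow 2
      exact continuous_eval.comp ((continuous_subtype_val.comp continuous_fst).prodMk
        continuous_snd)
    simpa using continuous_parametric_integral_of_continuous (μ := ν) huncurry isCompact_univ
  have hpos : ∀ f : W, f ≠ 0 → 0 < ∫ x, ‖(f : C(s, G)) x‖ ^ 2 ∂ν := by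
    intro f hf
    obtain ⟨x, hx⟩ : ∃ x, (f : C(s, G)) x ≠ 0 := by
      by_contra! h
      exact hf (Subtype.ext (ContinuousMap.ext h))
    refine Continuous.integral_pos_of_hasCompactSupport_nonneg_nonzero (x := x) ?_ ?_ ?_ ?_
    · exact ((f : C(s, G)).continuous.norm).pow 2
    · exact HasCompactSupport.of_compactSpace _
    · exact fun _ => sq_nonneg _
    · simpa using hx
  -- The sphere is empty exactly when `W` is trivial.
  rcases (Metric.sphere (0 : W) 1).eq_empty_or_nonempty with hempty | hne
  · refine ⟨0, le_rfl, fun f hf => ?_⟩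
    have : f = 0 := by
      by_contra h
      have h' : (⟨f, hf⟩ : W) ≠ 0 := by simpa [Subtype.ext_iff] using h
      have : ‖(⟨f, hf⟩ : W)‖⁻¹ • (⟨f, hf⟩ : W) ∈ Metric.sphere (0 : W) 1 := by
        rw [mem_sphere_zero_iff_norm, norm_smul, norm_inv, norm_norm,
          inv_mul_cancel₀ (norm_ne_zero_iff.2 h')]
      rw [hempty] at this
      exact this
    simp [this]
  · obtain ⟨f₀, hf₀, hmin⟩ := (isCompact_sphere (0 : W) 1).exists_isMinOn hne hcont.continuousOn
    have hm := hpos f₀ (ne_zero_of_mem_unit_sphere ⟨f₀, hf₀⟩)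
    refine ⟨(∫ x, ‖(f₀ : C(s, G)) x‖ ^ 2 ∂ν)⁻¹, inv_nonneg.2 hm.le, fun f hf => ?_⟩
    rw [inv_mul_eq_div, le_div_iff₀ hm]
    by_cases h : f = 0
    · simp [h]
    have hnorm : ‖f‖ ≠ 0 := norm_ne_zero_iff.2 h
    have hmem : ‖f‖⁻¹ • (⟨f, hf⟩ : W) ∈ Metric.sphere (0 : W) 1 := by
      rw [mem_sphere_zero_iff_norm, norm_smul, norm_inv, norm_norm]
      exact inv_mul_cancel₀ hnorm
    have hle := isMinOn_iff.1 hmin _ hmem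
    have heq : ∫ x, ‖((‖f‖⁻¹ • (⟨f, hf⟩ : W) : W) : C(s, G)) x‖ ^ 2 ∂ν =
        (‖f‖ ^ 2)⁻¹ * ∫ x, ‖f x‖ ^ 2 ∂ν := by
      rw [← integral_const_mul]
      congr 1 with x
      simp [norm_smul, mul_pow]
    rw [heq, inv_mul_eq_div, le_div_iff₀ (by positivity)] at hle
    linarith

/-! ### The reference element -/

section RefElem

variable {d : ℕ} {K : RefKind}

theorem convex_refElem (d : ℕ) (K : RefKind) : Convex ℝ (refElem d K) := by
  intro x hx y hy a b ha hb hab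
  cases K with
  | simplex =>
    refine ⟨fun i => ?_, ?_⟩
    · have := hx.1 i
      have := hy.1 i
      simp only [PiLp.add_apply, PiLp.smul_apply, smul_eq_mul]
      positivity
    · simp only [PiLp.add_apply, PiLp.smul_apply, smul_eq_mul, Finset.sum_add_distrib,
        ← Finset.mul_sum]
      nlinarith [hx.2, hy.2]
  | cube =>
    intro i
    have := hx i
    have := hy i
    simp only [PiLp.add_apply, PiLp.smul_apply, smul_eq_mul]
    constructor
    · have := (hx i).1
      have := (hy i).1
      positivity
    · nlinarith [(hx i).2, (hy i).2]

theorem isClosed_refElem (d : ℕ) (K : RefKind) : IsClosed (refElem d K) := by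
  cases K with
  | simplex =>
    simp only [refElem, ofPred_and, ofPred_forall]
    refine IsClosed.inter (isClosed_iInter fun i => isClosed_le (by fun_prop) (by fun_prop)) ?_
    exact isClosed_le (by fun_prop) (by fun_prop)
  | cube =>
    simp only [refElem, ofPred_and, ofPred_forall]
    exact isClosed_iInter fun i => (isClosed_le (by fun_prop) (by fun_prop)).inter
      (isClosed_le (by fun_prop) (by fun_prop))

theorem refElem_simplex_subset_cube (d : ℕ) : refElem d .simplex ⊆ refElem d .cube :=
  fun _ hx i => ⟨hx.1 i, (Finset.single_le_sum (fun j _ => hx.1 j) (Finset.mem_univ i)).trans hx.2⟩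

theorem isCompact_refElem (d : ℕ) (K : RefKind) : IsCompact (refElem d K) := by
  refine Metric.isCompact_of_isClosed_isBounded (isClosed_refElem d K) ?_
  have hcube : Bornology.IsBounded (refElem d .cube) := by
    refine (isBounded_iff_forall_norm_le).2 ⟨Real.sqrt d, fun x hx => ?_⟩
    rw [EuclideanSpace.norm_eq]
    refine Real.sqrt_le_sqrt ?_
    calc ∑ i, ‖x i‖ ^ 2 ≤ ∑ _i : Fin d, (1 : ℝ) := by
          refine Finset.sum_le_sum fun i _ => ?_
          rw [Real.norm_eq_abs, sq_abs]
          nlinarith [(hx i).1, (hx i).2]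
      _ = d := by simp
  cases K with
  | simplex => exact hcube.subset (refElem_simplex_subset_cube d)
  | cube => exact hcube

theorem interior_refElem_nonempty (d : ℕ) (K : RefKind) : (interior (refElem d K)).Nonempty := by
  cases K with
  | simplex =>
    refine ⟨WithLp.toLp 2 fun _ => ((d : ℝ) + 1)⁻¹, mem_interior.2
      ⟨{x | (∀ i, 0 < x i) ∧ ∑ i, x i < 1}, fun x hx => ⟨fun i => (hx.1 i).le, hx.2.le⟩, ?_, ?_, ?_⟩⟩
    · simp only [ofPred_and, ofPred_forall]
      refine IsOpen.inter (isOpen_iInter_of_finite fun i => ?_) ?_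
      · exact isOpen_lt (by fun_prop) (by fun_prop)
      · exact isOpen_lt (by fun_prop) (by fun_prop)
    · intro i
      simp only
      positivity
    · simp only [Finset.sum_const, Finset.card_univ, Fintype.card_fin, nsmul_eq_mul]
      rw [mul_inv_lt_iff₀ (by positivity)]
      linarith
  | cube =>
    refine ⟨WithLp.toLp 2 fun _ => 2⁻¹, mem_interior.2
      ⟨{x | ∀ i, 0 < x i ∧ x i < 1}, fun x hx i => ⟨(hx i).1.le, (hx i).2.le⟩, ?_, ?_⟩⟩
    · simp only [ofPred_and, ofPred_forall]
      exact isOpen_iInter_of_finite fun i => (isOpen_lt (by fun_prop) (by fun_prop)).inter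
        (isOpen_lt (by fun_prop) (by fun_prop))
    · intro i
      norm_num

theorem closure_interior_refElem (d : ℕ) (K : RefKind) :
    closure (interior (refElem d K)) = refElem d K := by
  rw [(convex_refElem d K).closure_interior_eq_closure_of_nonempty_interior
    (interior_refElem_nonempty d K), (isClosed_refElem d K).closure_eq]

/-- Facets are the sections of the reference element by supporting hyperplanes. -/
theorem exists_refFacet_eq (hd : d ≠ 0) (K : RefKind) (k : FacetIdx d K) :
    ∃ (n : Eu d) (c : ℝ), n ≠ 0 ∧ (∀ y ∈ refElem d K, inner ℝ n y ≤ c) ∧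
      refFacet d K k = refElem d K ∩ {x | inner ℝ n x = c} := by
  have hne : ∀ (i : Fin d) (r : ℝ), r ≠ 0 → EuclideanSpace.single i r ≠ 0 := by
    intro i r hr h
    simpa [hr] using congrArg (fun z : Eu d => z i) h
  have hinner : ∀ (i : Fin d) (r : ℝ) (y : Eu d),
      inner ℝ (EuclideanSpace.single i r) y = r * y i := by
    intro i r y
    simp [EuclideanSpace.inner_single_left]
  match K, k with
  | .simplex, none =>
    have hsum : ∀ y : Eu d, inner ℝ (WithLp.toLp 2 fun _ => 1 : Eu d) y = ∑ i, y i := by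
      intro y
      simp [PiLp.inner_apply]
    refine ⟨WithLp.toLp 2 fun _ => 1, 1, fun h => ?_, fun y hy => (hsum y).trans_le hy.2, ?_⟩
    · simpa using congrArg (fun z : Eu d => z ⟨0, Nat.pos_of_ne_zero hd⟩) h
    · ext x
      simp only [refFacet, mem_ofPred_eq, mem_inter_iff, hsum]
  | .simplex, some i =>
    refine ⟨EuclideanSpace.single i (-1), 0, hne i _ (by norm_num), fun y hy => ?_, ?_⟩
    · have := hy.1 i
      rw [hinner]
      linarith
    · ext x
      simp only [refFacet, mem_ofPred_eq, mem_inter_iff, hinner, neg_one_mul, neg_eq_zero]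
  | .cube, (i, false) =>
    refine ⟨EuclideanSpace.single i (-1), 0, hne i _ (by norm_num), fun y hy => ?_, ?_⟩
    · have := (hy i).1
      rw [hinner]
      linarith
    · ext x
      simp only [refFacet, mem_ofPred_eq, mem_inter_iff, hinner, neg_one_mul, neg_eq_zero]
  | .cube, (i, true) =>
    refine ⟨EuclideanSpace.single i 1, 1, hne i _ (by norm_num), fun y hy => ?_, ?_⟩
    · have := (hy i).2
      rw [hinner]
      linarith
    · ext x
      simp only [refFacet, mem_ofPred_eq, mem_inter_iff, hinner, one_mul]

theorem refFacet_subset (hd : d ≠ 0) (k : FacetIdx d K) : refFacet d K k ⊆ refElem d K := by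
  obtain ⟨n, c, -, -, h⟩ := exists_refFacet_eq hd K k
  rw [h]
  exact inter_subset_left

theorem isCompact_refFacet (hd : d ≠ 0) (k : FacetIdx d K) : IsCompact (refFacet d K k) := by
  obtain ⟨n, c, -, -, h⟩ := exists_refFacet_eq hd K k
  rw [h]
  exact (isCompact_refElem d K).inter_right (isClosed_eq (by fun_prop) (by fun_prop))

/-- From an interior point a small step along the outward normal stays in the element, while from a
point of the facet it would cross the supporting hyperplane. -/
theorem disjoint_interior_refFacet (hd : d ≠ 0) (k : FacetIdx d K) :
    Disjoint (interior (refElem d K)) (refFacet d K k) := by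
  obtain ⟨n, c, hn, hle, h⟩ := exists_refFacet_eq hd K k
  rw [Set.disjoint_left]
  intro x hx hxk
  rw [h] at hxk
  have hxc : inner ℝ n x = c := hxk.2
  have htend : Tendsto (fun t : ℝ => x + t • n) (𝓝[>] 0) (𝓝 x) := by
    have : Tendsto (fun t : ℝ => x + t • n) (𝓝 0) (𝓝 (x + (0 : ℝ) • n)) :=
      Continuous.tendsto (by fun_prop) _
    simpa using this.mono_left nhdsWithin_le_nhds
  obtain ⟨t, ht, ht0⟩ := ((htend.eventually (mem_interior_iff_mem_nhds.1 hx)).and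
    self_mem_nhdsWithin).exists
  have h1 := hle _ ht
  rw [inner_add_right, inner_smul_right, hxc, real_inner_self_eq_norm_sq] at h1
  have : 0 < t * ‖n‖ ^ 2 := mul_pos ht0 (pow_pos (norm_pos_iff.2 hn) 2)
  linarith

theorem euclideanHausdorffMeasure_refFacet_lt_top (hd : d ≠ 0) (k : FacetIdx d K) :
    μHE[d - 1] (refFacet d K k) < ⊤ := by
  obtain ⟨n, c, hn, -, h⟩ := exists_refFacet_eq hd K k
  refine euclideanHausdorffMeasure_hyperplane_lt_top (isCompact_refFacet hd k).isBounded hn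
    (c := c) fun x hx => ?_
  rw [h] at hx
  exact hx.2

/-! ### Polynomials -/

theorem contDiff_evalAt {n : WithTop ℕ∞} (q : MvPolynomial (Fin d) ℝ) :
    ContDiff ℝ n fun x : Eu d => evalAt x q := by
  unfold evalAt
  induction q using MvPolynomial.induction_on with
  | C r => simpa using contDiff_const
  | add p q hp hq => simpa using hp.add hq
  | mul_X p i hp =>
    simp only [map_mul, MvPolynomial.eval_X]
    exact hp.mul (by fun_prop)

theorem finiteDimensional_refPoly (d : ℕ) (K : RefKind) (p : ℕ) :
    FiniteDimensional ℝ (refPoly d K p) := by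
  have key : ∀ S : Set (Fin d →₀ ℕ), S.Finite →
      FiniteDimensional ℝ (MvPolynomial.restrictSupport ℝ S) := by
    intro S hS
    have := hS.to_subtype
    exact (MvPolynomial.basisRestrictSupport ℝ S).finiteDimensional_of_finite
  -- For either kind of element the admissible exponents lie in the box `[0, p]^d`.
  have hfin : {m : Fin d →₀ ℕ | ∀ i, m i ≤ p}.Finite := by
    refine Set.Finite.of_injOn (f := fun m : Fin d →₀ ℕ => (m : Fin d → ℕ)) (fun m hm => ?_)
      DFunLike.coe_injective.injOn (Set.finite_Iic (fun _ : Fin d => p))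
    exact fun i => hm i
  cases K with
  | simplex =>
    refine key _ (hfin.subset fun m hm i => ?_)
    refine le_trans ?_ (show (m.sum fun _ e => e) ≤ p from hm)
    by_cases h : i ∈ m.support
    · exact Finset.single_le_sum (f := fun i => m i) (fun _ _ => Nat.zero_le _) h
    · rw [Finsupp.notMem_support_iff.1 h]
      exact Nat.zero_le _
  | cube => exact key _ hfin

/-- The derivatives of polynomials, as continuous functions on the reference element. -/
def refDeriv (d : ℕ) (K : RefKind) :
    MvPolynomial (Fin d) ℝ →ₗ[ℝ] C(refElem d K, Eu d →L[ℝ] ℝ) where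
  toFun q := ⟨fun x => fderiv ℝ (fun y : Eu d => evalAt y q) x,
    ((contDiff_evalAt (n := 1) q).continuous_fderiv one_ne_zero).comp continuous_subtype_val⟩
  map_add' p q := by
    ext1 x
    have hp := (contDiff_evalAt (n := 1) p).differentiable one_ne_zero (x : Eu d)
    have hq := (contDiff_evalAt (n := 1) q).differentiable one_ne_zero (x : Eu d)
    simpa [evalAt] using fderiv_fun_add hp hq
  map_smul' c q := by
    ext1 x
    have hq := (contDiff_evalAt (n := 1) q).differentiable one_ne_zero (x : Eu d)
    simpa [evalAt] using fderiv_fun_const_smul hq c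

/-- Norm equivalence is applied to the space of derivatives rather than of polynomials, so constants
cause no trouble and only gradients appear on both sides. -/
theorem exists_norm_fderiv_sq_le (d : ℕ) (K : RefKind) : ∃ C : ℝ, 0 ≤ C ∧
    ∀ q ∈ refPoly d K 1, ∀ x ∈ refElem d K, ‖fderiv ℝ (fun y : Eu d => evalAt y q) x‖ ^ 2 ≤
      C * ∫ x in interior (refElem d K), ‖fderiv ℝ (fun y : Eu d => evalAt y q) x‖ ^ 2 := by
  have hK := isCompact_refElem d K
  have : CompactSpace (refElem d K) := isCompact_iff_compactSpace.1 hK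
  have := finiteDimensional_refPoly d K 1
  obtain ⟨C, hC, h⟩ := exists_norm_sq_le_setIntegral (μ := (volume : Measure (Eu d)))
    (closure_interior_refElem d K).ge ((refPoly d K 1).map (refDeriv d K))
  refine ⟨C, hC, fun q hq x hx => ?_⟩
  have hint : ∫ x in interior (refElem d K), ‖fderiv ℝ (fun y : Eu d => evalAt y q) x‖ ^ 2 =
      ∫ x : refElem d K, ‖refDeriv d K q x‖ ^ 2 ∂(volume.comap Subtype.val) := by
    -- The boundary of a convex set is a null set.
    rw [setIntegral_congr_set (interior_ae_eq_of_null_frontier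
      ((convex_refElem d K).addHaar_frontier volume))]
    exact (integral_subtype_comap hK.measurableSet
      (fun x => ‖fderiv ℝ (fun y : Eu d => evalAt y q) x‖ ^ 2)).symm
  rw [hint]
  refine le_trans ?_ (h _ (Submodule.mem_map_of_mem hq))
  gcongr
  exact (refDeriv d K q).norm_coe_le_norm ⟨x, hx⟩

end RefElem

/-! ### Geometry of meshes -/

namespace Mesh

variable {d : ℕ} {K : RefKind} {Ω : Set (Eu d)} (M : Mesh K Ω) {κ : ℝ}

theorem contDiff_map {n : WithTop ℕ∞} (T : Fin M.card) : ContDiff ℝ n (M.map T) := by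
  rw [contDiff_euclidean]
  intro i
  obtain ⟨q, -, hq⟩ := M.map_poly T i
  simp only [hq]
  exact contDiff_evalAt q

theorem isCompact_elem (T : Fin M.card) : IsCompact (M.elem T) :=
  (isCompact_refElem d K).image (M.contDiff_map (n := 0) T).continuous

theorem cell_subset_elem (T : Fin M.card) : M.cell T ⊆ M.elem T := image_mono interior_subset

theorem elem_subset_closure_cell (T : Fin M.card) : M.elem T ⊆ closure (M.cell T) := by
  rw [elem, ← closure_interior_refElem]
  exact image_closure_subset_closure_image (M.contDiff_map (n := 0) T).continuous

theorem diam_elem_pos (hd : d ≠ 0) (T : Fin M.card) : 0 < Metric.diam (M.elem T) := by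
  have : Nonempty (Fin d) := ⟨⟨0, Nat.pos_of_ne_zero hd⟩⟩
  obtain ⟨x, hx⟩ := interior_refElem_nonempty d K
  have hinf : (refElem d K).Infinite := infinite_of_mem_nhds x (mem_interior_iff_mem_nhds.1 hx)
  exact Metric.diam_pos (hinf.nontrivial.image_of_injOn (M.map_inj T)) (M.isCompact_elem T).isBounded

variable {M}

/-- The element `T` is needed: a mesh without elements is shape regular for every `κ`. -/
theorem ShapeRegular.pos (hM : M.ShapeRegular κ) (hd : d ≠ 0) (T : Fin M.card) : 0 < κ := by
  have : Nonempty (Fin d) := ⟨⟨0, Nat.pos_of_ne_zero hd⟩⟩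
  obtain ⟨x, hx⟩ := interior_refElem_nonempty d K
  have hinf : (refElem d K).Infinite := infinite_of_mem_nhds x (mem_interior_iff_mem_nhds.1 hx)
  obtain ⟨y, hy, z, hz, hyz⟩ := hinf.nontrivial
  have h := (hM T y hy z hz).1
  have h0 := mul_pos (M.diam_elem_pos hd T) (dist_pos.2 hyz)
  by_contra! hκ
  nlinarith [dist_nonneg (x := M.map T y) (y := M.map T z)]

theorem ShapeRegular.div_pos (hM : M.ShapeRegular κ) (hd : d ≠ 0) (T : Fin M.card) :
    0 < Metric.diam (M.elem T) / κ :=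
  _root_.div_pos (M.diam_elem_pos hd T) (hM.pos hd T)

theorem ShapeRegular.le_dist (hM : M.ShapeRegular κ) (hd : d ≠ 0) (T : Fin M.card) :
    ∀ x ∈ refElem d K, ∀ y ∈ refElem d K,
      Metric.diam (M.elem T) / κ * dist x y ≤ dist (M.map T x) (M.map T y) := by
  intro x hx y hy
  rw [div_mul_eq_mul_div, div_le_iff₀' (hM.pos hd T)]
  exact (hM T x hx y hy).1

theorem ShapeRegular.isOpen_cell (hM : M.ShapeRegular κ) (hd : d ≠ 0) (T : Fin M.card) :
    IsOpen (M.cell T) :=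
  isOpen_image_interior (hM.div_pos hd T) (closure_interior_refElem d K).ge (M.contDiff_map T)
    (hM.le_dist hd T)

variable (M) in
-- Since `I` is nonempty, a common point is the image of a point of some facet; by injectivity of
-- the element map that point would also be interior to the reference element.
theorem disjoint_cell (hd : d ≠ 0) {T T' : Fin M.card} (h : T ≠ T') :
    Disjoint (M.cell T) (M.cell T') := by
  obtain ⟨I, J, ⟨k, hk⟩, -, hI, -⟩ := M.regular T T' h
  rw [Set.disjoint_left]
  intro y hy hy'
  have hmem : y ∈ M.map T '' refElem d K ∩ M.map T' '' refElem d K :=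
    ⟨M.cell_subset_elem T hy, M.cell_subset_elem T' hy'⟩
  rw [hI] at hmem
  obtain ⟨x, hx, rfl⟩ := hmem
  obtain ⟨z, hz, hzx⟩ := hy
  have hxk : x ∈ refFacet d K k := mem_iInter₂.1 hx k hk
  obtain rfl := M.map_inj T (interior_subset hz) (refFacet_subset hd k hxk) hzx
  exact Set.disjoint_left.1 (disjoint_interior_refFacet hd k) hz hxk

variable (M) in
theorem facet_subset_elem (hd : d ≠ 0) (T : Fin M.card) (k : FacetIdx d K) :
    M.facet T k ⊆ M.elem T := image_mono (refFacet_subset hd k)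

variable (M) in
theorem isCompact_facet (hd : d ≠ 0) (T : Fin M.card) (k : FacetIdx d K) :
    IsCompact (M.facet T k) :=
  (isCompact_refFacet hd k).image (M.contDiff_map (n := 0) T).continuous

theorem ShapeRegular.euclideanHausdorffMeasure_facet_le (hM : M.ShapeRegular κ) (hd : d ≠ 0)
    (T : Fin M.card) (k : FacetIdx d K) :
    μHE[d - 1] (M.facet T k) ≤
      ENNReal.ofReal ((κ * Metric.diam (M.elem T)) ^ (d - 1)) * μHE[d - 1] (refFacet d K k) := by
  have hnn : 0 ≤ κ * Metric.diam (M.elem T) := mul_nonneg (hM.pos hd T).le Metric.diam_nonneg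
  have hlip : LipschitzOnWith (Real.toNNReal (κ * Metric.diam (M.elem T))) (M.map T)
      (refFacet d K k) := LipschitzOnWith.of_dist_le_mul fun x hx y hy => by
    rw [Real.coe_toNNReal _ hnn]
    exact (hM T x (refFacet_subset hd k hx) y (refFacet_subset hd k hy)).2
  rw [ENNReal.ofReal_pow hnn]
  exact euclideanHausdorffMeasure_image_le hlip (d - 1)

theorem ShapeRegular.euclideanHausdorffMeasure_facet_lt_top (hM : M.ShapeRegular κ) (hd : d ≠ 0)
    (T : Fin M.card) (k : FacetIdx d K) : μHE[d - 1] (M.facet T k) < ⊤ :=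
  (hM.euclideanHausdorffMeasure_facet_le hd T k).trans_lt
    (ENNReal.mul_lt_top ENNReal.ofReal_lt_top (euclideanHausdorffMeasure_refFacet_lt_top hd k))

theorem exists_facet_of_mem_faces {e : Set (Eu d)} (he : e ∈ M.faces) : ∃ T k, M.facet T k = e := by
  classical
  obtain ⟨p, -, hp⟩ := Finset.mem_image.1 he
  exact ⟨p.1, p.2, hp⟩

theorem exists_facet_minus {e : Set (Eu d)} (he : e ∈ M.faces) :
    ∃ k, M.facet (M.minus e) k = e := by
  obtain ⟨T, k, rfl⟩ := exists_facet_of_mem_faces he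
  exact (M.minus_spec T k).1

theorem norm_normal {e : Set (Eu d)} (he : e ∈ M.faces) : ‖M.normal e‖ = 1 := by
  obtain ⟨T, k, rfl⟩ := exists_facet_of_mem_faces he
  exact (M.minus_spec T k).2.1

theorem IsInterior.exists_facet_plus {e : Set (Eu d)} (he : M.IsInterior e) :
    ∃ k, M.facet (M.plus e) k = e := by
  obtain ⟨T, k, T', k', hne, rfl, h⟩ := he
  exact (M.plus_spec T k T' k' hne h.symm).2.1

theorem subset_elem_minus (hd : d ≠ 0) {e : Set (Eu d)} (he : e ∈ M.faces) :
    e ⊆ M.elem (M.minus e) := by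
  obtain ⟨k, hk⟩ := exists_facet_minus he
  rw [← hk]
  convert M.facet_subset_elem hd (M.minus e) k

theorem IsInterior.subset_elem_plus (hd : d ≠ 0) {e : Set (Eu d)} (he : M.IsInterior e) :
    e ⊆ M.elem (M.plus e) := by
  obtain ⟨k, hk⟩ := he.exists_facet_plus
  intro x hx
  rw [← hk] at hx
  exact M.facet_subset_elem hd _ k hx

/-! ### Traces -/

/-- `w` extends continuously from the open to the closed element. -/
def HasContExt {X : Type} [TopologicalSpace X] (M : Mesh K Ω) (T : Fin M.card) (w : Eu d → X) :
    Prop :=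
  ∃ W : Eu d → X, ContinuousOn W (M.elem T) ∧ EqOn w W (M.cell T)

/-- The open cell is dense in the closed element, so the limit from inside is unique: every
continuous extension computes the trace. -/
theorem traceFrom_eqOn {X : Type} [TopologicalSpace X] [T2Space X] {T : Fin M.card}
    {w W : Eu d → X} (hW : ContinuousOn W (M.elem T)) (h : EqOn w W (M.cell T)) :
    EqOn (M.traceFrom T w) W (M.elem T) := by
  intro x hx
  refine extendFrom_eq (M.elem_subset_closure_cell T hx) ?_
  refine Tendsto.congr' ?_ ((hW x hx).mono_left (nhdsWithin_mono x (M.cell_subset_elem T)))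
  filter_upwards [self_mem_nhdsWithin] with y hy
  exact (h hy).symm

section HasContExt

variable {X : Type} [TopologicalSpace X] [T2Space X] {T : Fin M.card} {w w' : Eu d → X}

theorem HasContExt.traceFrom_eqOn_cell (h : M.HasContExt T w) :
    EqOn (M.traceFrom T w) w (M.cell T) := by
  obtain ⟨W, hW, hwW⟩ := h
  exact fun x hx => (traceFrom_eqOn hW hwW (M.cell_subset_elem T hx)).trans (hwW hx).symm

theorem HasContExt.continuousOn_traceFrom (h : M.HasContExt T w) :
    ContinuousOn (M.traceFrom T w) (M.elem T) := by
  obtain ⟨W, hW, hwW⟩ := h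
  exact hW.congr (traceFrom_eqOn hW hwW)

theorem HasContExt.traceFrom_sub {X : Type} [NormedAddCommGroup X] {w w' : Eu d → X}
    (h : M.HasContExt T w) (h' : M.HasContExt T w') {x : Eu d} (hx : x ∈ M.elem T) :
    M.traceFrom T (fun y => w y - w' y) x = M.traceFrom T w x - M.traceFrom T w' x := by
  refine traceFrom_eqOn (W := fun y => M.traceFrom T w y - M.traceFrom T w' y)
    (h.continuousOn_traceFrom.sub h'.continuousOn_traceFrom) (fun y hy => ?_) hx
  simp only [h.traceFrom_eqOn_cell hy, h'.traceFrom_eqOn_cell hy]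

end HasContExt

theorem hasContExt_of_mem_space (hM : M.ShapeRegular κ) (hd : d ≠ 0) {p : ℕ} {v : Eu d → ℝ}
    (hv : v ∈ M.space p) (T : Fin M.card) : M.HasContExt T v := by
  obtain ⟨q, -, hq⟩ := hv T
  refine ⟨fun y => evalAt (Function.invFunOn (M.map T) (refElem d K) y) q, ?_, ?_⟩
  · exact (contDiff_evalAt (n := 0) q).continuous.comp_continuousOn
      (lipschitzOnWith_invFunOn (hM.div_pos hd T) (hM.le_dist hd T)).continuousOn
  · rintro _ ⟨x, hx, rfl⟩
    simp only [hq x hx, (M.map_inj T).leftInvOn_invFunOn (interior_subset hx)]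

/-- The continuous extension to the closed element of the gradient of the function that is given
on the reference element by the polynomial `q`. -/
def localGrad (M : Mesh K Ω) (T : Fin M.card) (q : MvPolynomial (Fin d) ℝ) (y : Eu d) : Eu d :=
  (InnerProductSpace.toDual ℝ (Eu d)).symm
    (pulledDeriv (M.map T) (refElem d K) (fun x => evalAt x q) y)

theorem continuousOn_localGrad (hM : M.ShapeRegular κ) (hd : d ≠ 0) (T : Fin M.card)
    (q : MvPolynomial (Fin d) ℝ) : ContinuousOn (M.localGrad T q) (M.elem T) :=
  (InnerProductSpace.toDual ℝ (Eu d)).symm.continuous.comp_continuousOn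
    (continuousOn_pulledDeriv (hM.div_pos hd T) (closure_interior_refElem d K).ge
      (M.contDiff_map T) (hM.le_dist hd T) (contDiff_evalAt q))

theorem hasGradientAt_localGrad (hM : M.ShapeRegular κ) (hd : d ≠ 0) {T : Fin M.card}
    {v : Eu d → ℝ} {q : MvPolynomial (Fin d) ℝ}
    (hq : ∀ x ∈ interior (refElem d K), v (M.map T x) = evalAt x q) {y : Eu d}
    (hy : y ∈ M.cell T) : HasGradientAt v (M.localGrad T q y) y := by
  rw [hasGradientAt_iff_hasFDerivAt, localGrad, LinearIsometryEquiv.apply_symm_apply]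
  exact hasFDerivAt_of_comp_eq (hM.div_pos hd T) (closure_interior_refElem d K).ge
    (M.contDiff_map T) (hM.le_dist hd T) (contDiff_evalAt q) hq hy

theorem brokenGrad_eqOn_cell (hM : M.ShapeRegular κ) (hd : d ≠ 0) {T : Fin M.card}
    {v : Eu d → ℝ} {q : MvPolynomial (Fin d) ℝ}
    (hq : ∀ x ∈ interior (refElem d K), v (M.map T x) = evalAt x q) :
    EqOn (M.brokenGrad v) (M.localGrad T q) (M.cell T) := by
  intro y hy
  rw [brokenGrad, if_pos (mem_iUnion.2 ⟨T, hy⟩)]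
  exact (hasGradientAt_localGrad hM hd hq hy).gradient

theorem hasContExt_brokenGrad (hM : M.ShapeRegular κ) (hd : d ≠ 0) {p : ℕ} {v : Eu d → ℝ}
    (hv : v ∈ M.space p) (T : Fin M.card) : M.HasContExt T (M.brokenGrad v) := by
  obtain ⟨q, -, hq⟩ := hv T
  exact ⟨_, continuousOn_localGrad hM hd T q, brokenGrad_eqOn_cell hM hd hq⟩

theorem brokenGrad_sub (hM : M.ShapeRegular κ) (hd : d ≠ 0) {p : ℕ} {v w : Eu d → ℝ}
    (hv : v ∈ M.space p) (hw : w ∈ M.space p) (y : Eu d) :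
    M.brokenGrad (v - w) y = M.brokenGrad v y - M.brokenGrad w y := by
  by_cases hy : y ∈ ⋃ T, M.cell T
  · obtain ⟨T, hT⟩ := mem_iUnion.1 hy
    obtain ⟨q, -, hq⟩ := hv T
    obtain ⟨r, -, hr⟩ := hw T
    have h1 := hasGradientAt_localGrad hM hd hq hT
    have h2 := hasGradientAt_localGrad hM hd hr hT
    simp only [brokenGrad, if_pos hy]
    rw [h1.gradient, h2.gradient]
    refine HasGradientAt.gradient ?_
    rw [hasGradientAt_iff_hasFDerivAt] at h1 h2 ⊢
    rw [map_sub]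
    exact h1.sub h2
  · simp only [brokenGrad, if_neg hy, sub_zero]

theorem hasContExt_flux (hM : M.ShapeRegular κ) (hd : d ≠ 0) {A : Eu d → Eu d →L[ℝ] Eu d}
    {α β : ℝ} (hA : M.IsDiffusion A α β) {p : ℕ} {v : Eu d → ℝ}
    (hv : v ∈ M.space p) (T : Fin M.card) : M.HasContExt T fun y => A y (M.brokenGrad v y) := by
  obtain ⟨B, hB, hAB⟩ := hA.piecewise T
  obtain ⟨G, hG, hvG⟩ := hasContExt_brokenGrad hM hd hv T
  exact ⟨fun y => B y (G y), hB.clm_apply hG, fun y hy => by simp only [hAB hy, hvG hy]⟩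

/-! ### Jumps and fluxes -/

section Faces

variable {e : Set (Eu d)} {p : ℕ} {u v w : Eu d → ℝ} {A : Eu d → Eu d →L[ℝ] Eu d} {α β : ℝ}

/-- Additivity is claimed only on `e`, where the limits defining the traces exist; elsewhere
`extendFrom` may return arbitrary values. -/
theorem jump_sub (hM : M.ShapeRegular κ) (hd : d ≠ 0) (he : e ∈ M.faces) (hv : v ∈ M.space p)
    (hw : w ∈ M.space p) {x : Eu d} (hx : x ∈ e) :
    M.jump (v - w) e x = M.jump v e x - M.jump w e x := by
  have key : ∀ T, x ∈ M.elem T →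
      M.traceFrom T (v - w) x = M.traceFrom T v x - M.traceFrom T w x := fun T hT =>
    (hasContExt_of_mem_space hM hd hv T).traceFrom_sub (hasContExt_of_mem_space hM hd hw T) hT
  by_cases hi : M.IsInterior e
  · simp only [jump, if_pos hi, key _ (subset_elem_minus hd he hx),
      key _ (hi.subset_elem_plus hd hx)]
    ring
  · simp only [jump, if_neg hi, key _ (subset_elem_minus hd he hx)]

theorem avgFlux_sub (hM : M.ShapeRegular κ) (hd : d ≠ 0) (hA : M.IsDiffusion A α β)
    (he : e ∈ M.faces) (hv : v ∈ M.space p) (hw : w ∈ M.space p) {x : Eu d} (hx : x ∈ e) :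
    M.avgFlux A (v - w) e x = M.avgFlux A v e x - M.avgFlux A w e x := by
  have key : ∀ T, x ∈ M.elem T → M.traceFrom T (fun y => A y (M.brokenGrad (v - w) y)) x =
      M.traceFrom T (fun y => A y (M.brokenGrad v y)) x -
        M.traceFrom T (fun y => A y (M.brokenGrad w y)) x := by
    intro T hT
    rw [← (hasContExt_flux hM hd hA hv T).traceFrom_sub (hasContExt_flux hM hd hA hw T) hT]
    simp only [brokenGrad_sub hM hd hv hw, map_sub]
  by_cases hi : M.IsInterior e
  · simp only [avgFlux, if_pos hi, key _ (subset_elem_minus hd he hx),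
      key _ (hi.subset_elem_plus hd hx), inner_sub_right]
    ring
  · simp only [avgFlux, if_neg hi, key _ (subset_elem_minus hd he hx), inner_sub_right]

theorem continuousOn_jump (hM : M.ShapeRegular κ) (hd : d ≠ 0) (he : e ∈ M.faces)
    (hv : v ∈ M.space p) : ContinuousOn (M.jump v e) e := by
  have key : ∀ T, ContinuousOn (M.traceFrom T v) (M.elem T) := fun T =>
    (hasContExt_of_mem_space hM hd hv T).continuousOn_traceFrom
  unfold jump
  by_cases hi : M.IsInterior e
  · simp only [if_pos hi]
    exact ((key _).mono (subset_elem_minus hd he)).sub ((key _).mono (hi.subset_elem_plus hd))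
  · simp only [if_neg hi]
    exact (key _).mono (subset_elem_minus hd he)

theorem continuousOn_avgFlux (hM : M.ShapeRegular κ) (hd : d ≠ 0) (hA : M.IsDiffusion A α β)
    (he : e ∈ M.faces) (hv : v ∈ M.space p) : ContinuousOn (M.avgFlux A v e) e := by
  have key : ∀ T, ContinuousOn (fun x => (inner ℝ (M.normal e)
      (M.traceFrom T (fun y => A y (M.brokenGrad v y)) x) : ℝ)) (M.elem T) := fun T =>
    continuousOn_const.inner (𝕜 := ℝ) (hasContExt_flux hM hd hA hv T).continuousOn_traceFrom
  unfold avgFlux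
  by_cases hi : M.IsInterior e
  · simp only [if_pos hi]
    exact (((key _).mono (subset_elem_minus hd he)).add
      ((key _).mono (hi.subset_elem_plus hd))).div_const 2
  · simp only [if_neg hi]
    exact (key _).mono (subset_elem_minus hd he)

theorem isCompact_of_mem_faces (hd : d ≠ 0) (he : e ∈ M.faces) : IsCompact e := by
  obtain ⟨T, k, rfl⟩ := exists_facet_of_mem_faces he
  exact M.isCompact_facet hd T k

theorem integrableOn_of_mem_faces (hM : M.ShapeRegular κ) (hd : d ≠ 0) (he : e ∈ M.faces)
    {f : Eu d → ℝ} (hf : ContinuousOn f e) : IntegrableOn f e μHE[d - 1] := by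
  have hc := isCompact_of_mem_faces hd he
  obtain ⟨T, k, rfl⟩ := exists_facet_of_mem_faces he
  -- On `ℝ^d` the measure `μHE[d - 1]` is not locally finite, so integrability of continuous
  -- functions on compact sets is used for its restriction to the face.
  have : IsFiniteMeasure ((μHE[d - 1] : Measure (Eu d)).restrict (M.facet T k)) :=
    ⟨by simpa using hM.euclideanHausdorffMeasure_facet_lt_top hd T k⟩
  have h := hf.integrableOn_compact (μ := (μHE[d - 1]).restrict (M.facet T k)) hc
  rwa [IntegrableOn, Measure.restrict_restrict hc.measurableSet, inter_self] at h

theorem mem_faces_of_mem_dgFaces {ΓD : Set (Eu d)} (he : e ∈ M.dgFaces ΓD) : e ∈ M.faces := by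
  classical
  exact (Finset.mem_filter.1 he).1

end Faces

/-! ### Volume integrals -/

section Volume

variable {p : ℕ} {u v w : Eu d → ℝ} {A : Eu d → Eu d →L[ℝ] Eu d} {α β : ℝ}

theorem HasContExt.integrableOn_cell (hM : M.ShapeRegular κ) (hd : d ≠ 0) {f : Eu d → ℝ}
    {T : Fin M.card} (hf : M.HasContExt T f) : IntegrableOn f (M.cell T) volume := by
  obtain ⟨W, hW, hfW⟩ := hf
  exact ((hW.integrableOn_compact (M.isCompact_elem T)).mono_set (M.cell_subset_elem T)).congr_fun
    (fun x hx => (hfW hx).symm) (hM.isOpen_cell hd T).measurableSet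

/-- Because the broken gradient is set to zero off the open cells, the union of the faces need not
be shown to be null. -/
theorem integrableOn_of_hasContExt (hM : M.ShapeRegular κ) (hd : d ≠ 0) (hΩ : MeasurableSet Ω)
    {f : Eu d → ℝ} (hf : ∀ T, M.HasContExt T f) (h0 : ∀ x ∉ ⋃ T, M.cell T, f x = 0) :
    IntegrableOn f Ω volume := by
  refine IntegrableOn.of_forall_sdiff_eq_zero (s := ⋃ T, M.cell T) ?_ hΩ fun x hx => h0 x hx.2
  exact integrableOn_finite_iUnion.2 fun T => (hf T).integrableOn_cell hM hd

theorem setIntegral_eq_sum_cell (hM : M.ShapeRegular κ) (hd : d ≠ 0) (hΩ : MeasurableSet Ω)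
    {f : Eu d → ℝ} (hf : ∀ T, M.HasContExt T f) (h0 : ∀ x ∉ ⋃ T, M.cell T, f x = 0) :
    ∫ x in Ω, f x = ∑ T, ∫ x in M.cell T, f x := by
  have hmeas := fun T => (hM.isOpen_cell hd T).measurableSet
  rw [← integral_iUnion_fintype hmeas (fun T T' h => M.disjoint_cell hd h)
    fun T => (hf T).integrableOn_cell hM hd]
  exact setIntegral_eq_of_subset_of_forall_sdiff_eq_zero
    hΩ (iUnion_subset M.subset) fun x hx => h0 x hx.2

variable (M) in
theorem brokenGrad_of_notMem (v : Eu d → ℝ) {x : Eu d} (hx : x ∉ ⋃ T, M.cell T) :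
    M.brokenGrad v x = 0 := if_neg hx

theorem hasContExt_inner_flux (hM : M.ShapeRegular κ) (hd : d ≠ 0) (hA : M.IsDiffusion A α β)
    (hu : u ∈ M.space p) (hv : v ∈ M.space p) (T : Fin M.card) :
    M.HasContExt T fun x => (inner ℝ (A x (M.brokenGrad u x)) (M.brokenGrad v x) : ℝ) := by
  obtain ⟨W, hW, hAW⟩ := hasContExt_flux hM hd hA hu T
  obtain ⟨G, hG, hvG⟩ := hasContExt_brokenGrad hM hd hv T
  exact ⟨fun x => inner ℝ (W x) (G x), hW.inner hG, fun y hy => by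
    have := hAW hy
    simp only at this
    simp only [this, hvG hy]⟩

theorem integrableOn_inner_flux (hM : M.ShapeRegular κ) (hd : d ≠ 0) (hΩ : MeasurableSet Ω)
    (hA : M.IsDiffusion A α β) (hu : u ∈ M.space p) (hv : v ∈ M.space p) :
    IntegrableOn (fun x => (inner ℝ (A x (M.brokenGrad u x)) (M.brokenGrad v x) : ℝ)) Ω volume :=
  integrableOn_of_hasContExt hM hd hΩ (hasContExt_inner_flux hM hd hA hu hv) fun x hx => by
    rw [M.brokenGrad_of_notMem v hx, inner_zero_right]

theorem hasContExt_norm_sq_brokenGrad (hM : M.ShapeRegular κ) (hd : d ≠ 0)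
    (hv : v ∈ M.space p) (T : Fin M.card) :
    M.HasContExt T fun x => ‖M.brokenGrad v x‖ ^ 2 := by
  obtain ⟨G, hG, hvG⟩ := hasContExt_brokenGrad hM hd hv T
  exact ⟨fun x => ‖G x‖ ^ 2, hG.norm.pow 2, fun y hy => by simp only [hvG hy]⟩

end Volume

/-! ### Bilinearity of the form -/

section Form

variable {p : ℕ} {u v w : Eu d → ℝ} {A : Eu d → Eu d →L[ℝ] Eu d} {α β : ℝ}

theorem form_sub_left (hM : M.ShapeRegular κ) (hd : d ≠ 0) (hΩ : MeasurableSet Ω)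
    (hA : M.IsDiffusion A α β) (ΓD : Set (Eu d)) (σ : ℝ) (hu : u ∈ M.space p)
    (hv : v ∈ M.space p) (hw : w ∈ M.space p) :
    M.form ΓD A σ (u - v) w = M.form ΓD A σ u w - M.form ΓD A σ v w := by
  have h1 : ∫ x in Ω, (inner ℝ (A x (M.brokenGrad (u - v) x)) (M.brokenGrad w x) : ℝ) =
      (∫ x in Ω, (inner ℝ (A x (M.brokenGrad u x)) (M.brokenGrad w x) : ℝ)) -
        ∫ x in Ω, (inner ℝ (A x (M.brokenGrad v x)) (M.brokenGrad w x) : ℝ) := by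
    rw [← integral_sub (integrableOn_inner_flux hM hd hΩ hA hu hw)
      (integrableOn_inner_flux hM hd hΩ hA hv hw)]
    simp only [brokenGrad_sub hM hd hu hv, map_sub, inner_sub_left]
  rw [form, form, form, h1, sub_sub_sub_comm, ← Finset.sum_sub_distrib]
  congr 1
  refine Finset.sum_congr rfl fun e he => ?_
  replace he := mem_faces_of_mem_dgFaces he
  have hint : ∀ {f g : Eu d → ℝ}, ContinuousOn f e → ContinuousOn g e →
      IntegrableOn (fun x => f x * g x) e μHE[d - 1] := fun hf hg =>
    integrableOn_of_mem_faces hM hd he (hf.mul hg)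
  have hem := (isCompact_of_mem_faces hd he).measurableSet
  have hju := continuousOn_jump hM hd he hu
  have hjv := continuousOn_jump hM hd he hv
  have hjw := continuousOn_jump hM hd he hw
  have hau := continuousOn_avgFlux hM hd hA he hu
  have hav := continuousOn_avgFlux hM hd hA he hv
  have haw := continuousOn_avgFlux hM hd hA he hw
  have h2 : ∫ x in e, M.avgFlux A (u - v) e x * M.jump w e x ∂μHE[d - 1] =
      (∫ x in e, M.avgFlux A u e x * M.jump w e x ∂μHE[d - 1]) -
        ∫ x in e, M.avgFlux A v e x * M.jump w e x ∂μHE[d - 1] := by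
    rw [← integral_sub (hint hau hjw) (hint hav hjw)]
    refine setIntegral_congr_fun hem fun x hx => ?_
    simp only [avgFlux_sub hM hd hA he hu hv hx, sub_mul]
  have h3 : ∫ x in e, M.avgFlux A w e x * M.jump (u - v) e x ∂μHE[d - 1] =
      (∫ x in e, M.avgFlux A w e x * M.jump u e x ∂μHE[d - 1]) -
        ∫ x in e, M.avgFlux A w e x * M.jump v e x ∂μHE[d - 1] := by
    rw [← integral_sub (hint haw hju) (hint haw hjv)]
    refine setIntegral_congr_fun hem fun x hx => ?_
    simp only [jump_sub hM hd he hu hv hx, mul_sub]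
  have h4 : ∫ x in e, M.jump (u - v) e x * M.jump w e x ∂μHE[d - 1] =
      (∫ x in e, M.jump u e x * M.jump w e x ∂μHE[d - 1]) -
        ∫ x in e, M.jump v e x * M.jump w e x ∂μHE[d - 1] := by
    rw [← integral_sub (hint hju hjw) (hint hjv hjw)]
    refine setIntegral_congr_fun hem fun x hx => ?_
    simp only [jump_sub hM hd he hu hv hx, sub_mul]
  rw [h2, h3, h4]
  ring

/-- The volume term is symmetric because `A` is; the two flux terms trade places. -/
theorem form_symm (hA : M.IsDiffusion A α β) (ΓD : Set (Eu d)) (σ : ℝ) (u v : Eu d → ℝ) :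
    M.form ΓD A σ u v = M.form ΓD A σ v u := by
  have h1 : ∫ x in Ω, (inner ℝ (A x (M.brokenGrad u x)) (M.brokenGrad v x) : ℝ) =
      ∫ x in Ω, (inner ℝ (A x (M.brokenGrad v x)) (M.brokenGrad u x) : ℝ) := by
    refine integral_congr_ae ?_
    filter_upwards [hA.symm] with x hx
    rw [hx, real_inner_comm]
  rw [form, form, h1]
  congr 1
  refine Finset.sum_congr rfl fun e _ => ?_
  simp only [mul_comm (M.jump u e _)]
  ring

theorem form_sub_right (hM : M.ShapeRegular κ) (hd : d ≠ 0) (hΩ : MeasurableSet Ω)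
    (hA : M.IsDiffusion A α β) (ΓD : Set (Eu d)) (σ : ℝ) (hu : u ∈ M.space p)
    (hv : v ∈ M.space p) (hw : w ∈ M.space p) :
    M.form ΓD A σ w (u - v) = M.form ΓD A σ w u - M.form ΓD A σ w v := by
  rw [form_symm hA, form_sub_left hM hd hΩ hA ΓD σ hu hv hw, form_symm hA ΓD σ u,
    form_symm hA ΓD σ v]

end Form

end Mesh

/-! ### The discrete trace inequality -/

namespace Mesh

variable {d : ℕ} {K : RefKind} {Ω : Set (Eu d)} {M : Mesh K Ω} {κ : ℝ}

theorem norm_localGrad (T : Fin M.card) (q : MvPolynomial (Fin d) ℝ) (y : Eu d) :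
    ‖M.localGrad T q y‖ = ‖pulledDeriv (M.map T) (refElem d K) (fun x => evalAt x q) y‖ :=
  LinearIsometryEquiv.norm_map _ _

/-- Scaling from the element to the reference element: the Lipschitz bound `κ h` of the element map
enters squared through the gradient, and the lower bound `h / κ` to the power `-d` through the
volume, where `h` is the diameter of the element. -/
theorem setIntegral_norm_fderiv_sq_le (hM : M.ShapeRegular κ) (hd : d ≠ 0) (T : Fin M.card)
    (q : MvPolynomial (Fin d) ℝ) :
    ∫ x in interior (refElem d K), ‖fderiv ℝ (fun y : Eu d => evalAt y q) x‖ ^ 2 ≤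
      (κ * Metric.diam (M.elem T)) ^ 2 * ((Metric.diam (M.elem T) / κ)⁻¹ ^ d *
        ∫ y in M.cell T, ‖M.localGrad T q y‖ ^ 2) := by
  have ha := hM.div_pos hd T
  have hb : 0 ≤ κ * Metric.diam (M.elem T) := mul_nonneg (hM.pos hd T).le Metric.diam_nonneg
  have hcl := (closure_interior_refElem d K).ge
  have hF : ContDiff ℝ 1 (M.map T) := M.contDiff_map T
  have hmeas : Measurable (M.map T) := hF.continuous.measurable
  set c : ENNReal := ENNReal.ofReal ((Metric.diam (M.elem T) / κ)⁻¹ ^ d) with hc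
  have hmap : (volume.restrict (interior (refElem d K))).map (M.map T) ≤
      c • volume.restrict (M.cell T) := volume_restrict_map_le ha hmeas fun x hx y hy =>
    hM.le_dist hd T x (interior_subset hx) y (interior_subset hy)
  have hint : IntegrableOn (fun y => ‖M.localGrad T q y‖ ^ 2) (M.cell T) volume :=
    HasContExt.integrableOn_cell hM hd
      ⟨_, (continuousOn_localGrad hM hd T q).norm.pow 2, fun _ _ => rfl⟩
  have hint' : Integrable (fun y => ‖M.localGrad T q y‖ ^ 2) (c • volume.restrict (M.cell T)) :=
    Integrable.smul_measure hint ENNReal.ofReal_ne_top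
  have hintmap := hint'.mono_measure hmap
  have hcomp : IntegrableOn (fun x => ‖M.localGrad T q (M.map T x)‖ ^ 2)
      (interior (refElem d K)) volume := hintmap.comp_measurable hmeas
  calc ∫ x in interior (refElem d K), ‖fderiv ℝ (fun y : Eu d => evalAt y q) x‖ ^ 2
      ≤ ∫ x in interior (refElem d K),
          (κ * Metric.diam (M.elem T)) ^ 2 * ‖M.localGrad T q (M.map T x)‖ ^ 2 := by
        refine setIntegral_mono_on ?_ (hcomp.const_mul _) isOpen_interior.measurableSet ?_
        · have hcont : Continuous fun x => ‖fderiv ℝ (fun y : Eu d => evalAt y q) x‖ ^ 2 :=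
            ((contDiff_evalAt (n := 1) q).continuous_fderiv one_ne_zero).norm.pow 2
          exact (hcont.continuousOn.integrableOn_compact (isCompact_refElem d K)).mono_set
            interior_subset
        · intro x hx
          rw [norm_localGrad, ← mul_pow]
          gcongr
          exact norm_fderiv_le_norm_pulledDeriv ha hcl hF (hM.le_dist hd T) hb
            (fun x hx y hy => (hM T x hx y hy).2) hx
    _ = (κ * Metric.diam (M.elem T)) ^ 2 *
          ∫ y, ‖M.localGrad T q y‖ ^ 2
            ∂((volume.restrict (interior (refElem d K))).map (M.map T)) := by
        rw [integral_const_mul, integral_map hmeas.aemeasurable hintmap.aestronglyMeasurable]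
    _ ≤ (κ * Metric.diam (M.elem T)) ^ 2 *
          ∫ y, ‖M.localGrad T q y‖ ^ 2 ∂(c • volume.restrict (M.cell T)) := by
        refine mul_le_mul_of_nonneg_left ?_ (sq_nonneg _)
        exact integral_mono_measure hmap (ae_of_all _ fun _ => sq_nonneg _) hint'
    _ = _ := by
        rw [integral_smul_measure, hc, ENNReal.toReal_ofReal (by positivity), smul_eq_mul]

/-- The powers of the diameter `h` cancel: `1` from the weight, `d - 1` from the facet measure, `-2`
and `2` from mapping the gradient to the reference element and back, `-d` from the volume. -/
theorem exists_trace_inequality (hd : d ≠ 0) (K : RefKind) (κ : ℝ) : ∃ C : ℝ, 0 ≤ C ∧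
    ∀ (Ω : Set (Eu d)) (M : Mesh K Ω), M.ShapeRegular κ → ∀ v ∈ M.space 1, ∀ T k,
      Metric.diam (M.elem T) *
          ∫ x in M.facet T k, ‖M.traceFrom T (M.brokenGrad v) x‖ ^ 2 ∂μHE[d - 1] ≤
        C * ∫ x in M.cell T, ‖M.brokenGrad v x‖ ^ 2 := by
  obtain ⟨C, hC, hsup⟩ := exists_norm_fderiv_sq_le d K
  -- The sum over all facets bounds the measure of each one uniformly.
  set m : ℝ := ∑ k : FacetIdx d K, (μHE[d - 1] (refFacet d K k)).toReal with hm
  have hm0 : 0 ≤ m := Finset.sum_nonneg fun _ _ => ENNReal.toReal_nonneg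
  -- The exponent is `(d - 1) + 2 + 2 + d`, one `κ` for each `h` or `h⁻¹` apart from the weight. The
  -- absolute value is needed because `C` is chosen before `κ` is known to be positive.
  refine ⟨|κ| ^ (2 * d + 3) * (C * m), by positivity, fun Ω M hM v hv T k => ?_⟩
  obtain ⟨q, hq1, hq⟩ := hv T
  have hκ := hM.pos hd T
  have hh := M.diam_elem_pos hd T
  have ha := hM.div_pos hd T
  rw [abs_of_pos hκ]
  set h := Metric.diam (M.elem T) with hhdef
  have hcl := (closure_interior_refElem d K).ge
  have hgrad := brokenGrad_eqOn_cell hM hd hq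
  have htrace := traceFrom_eqOn (continuousOn_localGrad hM hd T q) hgrad
  have hIq := setIntegral_norm_fderiv_sq_le hM hd T q
  set I := ∫ x in interior (refElem d K), ‖fderiv ℝ (fun y : Eu d => evalAt y q) x‖ ^ 2
  have hI0 : 0 ≤ I := integral_nonneg fun _ => sq_nonneg _
  have hX : ∫ x in M.cell T, ‖M.brokenGrad v x‖ ^ 2 =
      ∫ x in M.cell T, ‖M.localGrad T q x‖ ^ 2 :=
    setIntegral_congr_fun (hM.isOpen_cell hd T).measurableSet fun x hx => by
      simp only [hgrad hx]
  rw [hX]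
  set X := ∫ x in M.cell T, ‖M.localGrad T q x‖ ^ 2
  have hX0 : 0 ≤ X := integral_nonneg fun _ => sq_nonneg _
  have hmeasure : (μHE[d - 1]).real (M.facet T k) ≤ (κ * h) ^ (d - 1) * m := by
    have h1 := hM.euclideanHausdorffMeasure_facet_le hd T k
    have h2 := ENNReal.toReal_mono (ENNReal.mul_lt_top ENNReal.ofReal_lt_top
      (euclideanHausdorffMeasure_refFacet_lt_top hd k)).ne h1
    rw [ENNReal.toReal_mul, ENNReal.toReal_ofReal (by positivity)] at h2
    refine h2.trans ?_
    gcongr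
    exact Finset.single_le_sum (f := fun k : FacetIdx d K => (μHE[d - 1] (refFacet d K k)).toReal)
      (fun _ _ => ENNReal.toReal_nonneg) (Finset.mem_univ k)
  have hpoint : ∀ x ∈ M.facet T k,
      ‖‖M.traceFrom T (M.brokenGrad v) x‖ ^ 2‖ ≤ C * I * ((h / κ)⁻¹) ^ 2 := by
    intro x hx
    have hxT := M.facet_subset_elem hd T k hx
    rw [Real.norm_of_nonneg (sq_nonneg _), htrace hxT, norm_localGrad]
    calc _ ≤ (‖fderiv ℝ (fun y : Eu d => evalAt y q)
            (Function.invFunOn (M.map T) (refElem d K) x)‖ * (h / κ)⁻¹) ^ 2 := by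
          gcongr
          exact norm_pulledDeriv_le ha hcl (M.contDiff_map T) (hM.le_dist hd T) hxT
      _ ≤ _ := by
          rw [mul_pow]
          gcongr
          exact hsup q hq1 _ (Function.invFunOn_mem hxT)
  have hbound := (le_abs_self _).trans (norm_setIntegral_le_of_norm_le_const
    (hM.euclideanHausdorffMeasure_facet_lt_top hd T k) hpoint)
  obtain ⟨n, rfl⟩ : ∃ n, d = n + 1 := ⟨d - 1, by omega⟩
  calc h * ∫ x in M.facet T k, ‖M.traceFrom T (M.brokenGrad v) x‖ ^ 2 ∂μHE[n + 1 - 1]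
      ≤ h * (C * I * ((h / κ)⁻¹) ^ 2 * ((κ * h) ^ n * m)) := by
        gcongr
        exact hbound.trans (by gcongr; exact hmeasure)
    _ ≤ h * (C * ((κ * h) ^ 2 * ((h / κ)⁻¹ ^ (n + 1) * X)) * ((h / κ)⁻¹) ^ 2 *
          ((κ * h) ^ n * m)) := by gcongr
    _ = κ ^ (2 * (n + 1) + 3) * (C * m) * X := by
        rw [inv_div]
        simp only [mul_pow, div_pow]
        field_simp
        ring

/-! ### Bounds of the coefficient -/

section Coefficient

variable {A : Eu d → Eu d →L[ℝ] Eu d} {α β : ℝ}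

/-- Cauchy–Schwarz for the semidefinite form of `B`, obtained by expanding it at `s • v ± w`. The
weighted additive form survives integration and summation without square roots; the product form is
recovered once, at the end, by `le_mul_of_forall_weights`. -/
theorem abs_inner_le_of_nonneg {B : Eu d →L[ℝ] Eu d}
    (hsymm : ∀ v w, inner ℝ (B v) w = (inner ℝ v (B w) : ℝ)) (hpos : ∀ v, 0 ≤ (inner ℝ (B v) v : ℝ))
    {s : ℝ} (hs : 0 < s) (v w : Eu d) :
    |(inner ℝ (B v) w : ℝ)| ≤ (s * inner ℝ (B v) v + s⁻¹ * inner ℝ (B w) w) / 2 := by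
  have key : ∀ t : ℝ, 0 ≤ s * inner ℝ (B v) v + 2 * t * inner ℝ (B v) w +
      t ^ 2 * s⁻¹ * inner ℝ (B w) w := by
    intro t
    have h := hpos (s • v + t • w)
    have hsw : inner ℝ (B w) v = (inner ℝ (B v) w : ℝ) := by rw [hsymm, real_inner_comm]
    simp only [map_add, map_smul, inner_add_left, inner_add_right, real_inner_smul_left,
      real_inner_smul_right, hsw] at h
    have h2 := mul_nonneg (inv_nonneg.2 hs.le) h
    refine h2.trans_eq ?_
    field_simp
    ring
  rw [abs_le]
  constructor
  · linarith [key 1]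
  · linarith [key (-1)]

/-- Cauchy–Schwarz for `B` with `w = B v` and weight `β` gives `‖B v‖² ≤ (β² ‖v‖² + ‖B v‖²) / 2`. -/
theorem norm_apply_le_of_bounds {B : Eu d →L[ℝ] Eu d} (hβ : 0 < β)
    (hsymm : ∀ v w, inner ℝ (B v) w = (inner ℝ v (B w) : ℝ))
    (hB : ∀ v, 0 ≤ (inner ℝ (B v) v : ℝ) ∧ (inner ℝ (B v) v : ℝ) ≤ β * ‖v‖ ^ 2) (v : Eu d) :
    ‖B v‖ ≤ β * ‖v‖ := by
  have h := (le_abs_self _).trans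
    (abs_inner_le_of_nonneg hsymm (fun v => (hB v).1) hβ v (B v))
  rw [real_inner_self_eq_norm_sq] at h
  have h1 := mul_le_mul_of_nonneg_left (hB v).2 hβ.le
  have h2 := mul_le_mul_of_nonneg_left (hB (B v)).2 (inv_nonneg.2 hβ.le)
  rw [inv_mul_cancel_left₀ hβ.ne'] at h2
  refine abs_le_of_sq_le_sq' ?_ (by positivity) |>.2
  nlinarith

/-- A set of full measure in the open cell is dense in the closed element. Thus the almost
everywhere bounds on `A` reach the facets, which the volume measure cannot see. -/
theorem le_on_elem_of_ae (hM : M.ShapeRegular κ) (hd : d ≠ 0) {T : Fin M.card} {f g : Eu d → ℝ}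
    (hf : ContinuousOn f (M.elem T)) (hg : ContinuousOn g (M.elem T))
    (h : ∀ᵐ x ∂(volume.restrict (M.cell T)), f x ≤ g x) {x : Eu d} (hx : x ∈ M.elem T) :
    f x ≤ g x := by
  have hopen := hM.isOpen_cell hd T
  have hsub : M.cell T ∩ {y | f y ≤ g y} ⊆ M.elem T :=
    inter_subset_left.trans (M.cell_subset_elem T)
  have hmem : x ∈ closure (M.cell T ∩ {y | f y ≤ g y}) := by
    rw [mem_closure_iff]
    intro U hU hxU
    have hne := mem_closure_iff.1 (M.elem_subset_closure_cell T hx) U hU hxU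
    by_contra hemp
    rw [ae_restrict_iff' hopen.measurableSet] at h
    refine ((hU.inter hopen).measure_pos volume hne).ne' (measure_mono_null ?_ h)
    intro y hy hyle
    exact hemp ⟨y, hy.1, hy.2, hyle hy.2⟩
  exact ContinuousWithinAt.closure_le hmem ((hf x hx).mono hsub) ((hg x hx).mono hsub)
    fun y hy => hy.2

theorem norm_traceFrom_flux_le (hM : M.ShapeRegular κ) (hd : d ≠ 0) (hα : 0 < α) (hβ : 0 < β)
    (hA : M.IsDiffusion A α β) {p : ℕ} {v : Eu d → ℝ} (hv : v ∈ M.space p) {T : Fin M.card}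
    {x : Eu d} (hx : x ∈ M.elem T) :
    ‖M.traceFrom T (fun y => A y (M.brokenGrad v y)) x‖ ≤
      β * ‖M.traceFrom T (M.brokenGrad v) x‖ := by
  have hflux := hasContExt_flux hM hd hA hv T
  have hgrad := hasContExt_brokenGrad hM hd hv T
  refine le_on_elem_of_ae hM hd hflux.continuousOn_traceFrom.norm
    (g := fun x => β * ‖M.traceFrom T (M.brokenGrad v) x‖)
    (continuousOn_const.mul hgrad.continuousOn_traceFrom.norm) ?_ hx
  have hsub : M.cell T ⊆ Ω := M.subset T
  filter_upwards [ae_restrict_of_ae_restrict_of_subset hsub hA.symm,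
    ae_restrict_of_ae_restrict_of_subset hsub hA.bounds,
    ae_restrict_mem (hM.isOpen_cell hd T).measurableSet] with y hsymm hb hy
  rw [hflux.traceFrom_eqOn_cell hy, hgrad.traceFrom_eqOn_cell hy]
  exact norm_apply_le_of_bounds hβ hsymm
    (fun w => ⟨le_trans (by positivity) (hb w).1, (hb w).2⟩) _

end Coefficient

/-! ### Boundedness of the form -/

section Bounded

variable {A : Eu d → Eu d →L[ℝ] Eu d} {α β : ℝ} {e : Set (Eu d)} {v w : Eu d → ℝ}

theorem abs_integral_mul_le {X : Type*} [MeasurableSpace X] {ν : Measure X} {f g : X → ℝ}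
    (hf : Integrable (fun x => f x ^ 2) ν) (hg : Integrable (fun x => g x ^ 2) ν) {c : ℝ}
    (hc : 0 < c) :
    |∫ x, f x * g x ∂ν| ≤ (c * ∫ x, f x ^ 2 ∂ν + c⁻¹ * ∫ x, g x ^ 2 ∂ν) / 2 := by
  rw [← integral_const_mul, ← integral_const_mul, ← integral_add (hf.const_mul c)
    (hg.const_mul c⁻¹), ← integral_div, ← Real.norm_eq_abs]
  refine norm_integral_le_of_norm_le (((hf.const_mul c).add (hg.const_mul c⁻¹)).div_const 2)
    (ae_of_all _ fun x => ?_)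
  have h1 : 0 ≤ c⁻¹ * (c * f x - g x) ^ 2 := by positivity
  have h2 : 0 ≤ c⁻¹ * (c * f x + g x) ^ 2 := by positivity
  have e1 : c⁻¹ * (c * f x - g x) ^ 2 = c * f x ^ 2 + c⁻¹ * g x ^ 2 - 2 * (f x * g x) := by
    field_simp
    ring
  have e2 : c⁻¹ * (c * f x + g x) ^ 2 = c * f x ^ 2 + c⁻¹ * g x ^ 2 + 2 * (f x * g x) := by
    field_simp
    ring
  simp only [Real.norm_eq_abs]
  rw [abs_le]
  constructor <;> linarith

/-- A face of zero diameter would be at most a point, hence null in dimension `d - 1 > 0`; here `d ≥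
2` matters. This settles the case of division by zero in `σ / diam e` without a proof that faces
have positive diameter. -/
theorem restrict_eq_zero_of_diam_eq_zero (hd : 2 ≤ d) (he : e ∈ M.faces)
    (h : Metric.diam e = 0) : (μHE[d - 1] : Measure (Eu d)).restrict e = 0 := by
  have hsub : e.Subsingleton := by
    intro x hx y hy
    have := Metric.dist_le_diam_of_mem (isCompact_of_mem_faces (by omega) he).isBounded hx hy
    rw [h] at this
    exact dist_le_zero.1 this
  rw [Measure.restrict_eq_zero, Measure.euclideanHausdorffMeasure_def, Measure.smul_apply]
  have := Measure.nullSingletonClass_hausdorff (X := Eu d) (d := ((d - 1 : ℕ) : ℝ))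
    (by exact_mod_cast (by omega : 0 < d - 1))
  rw [hsub.measure_zero, smul_zero]

/-- The sum of the squared `L²`-norms of the gradient over the elements with the facet `e`. -/
def facetEnergy (M : Mesh K Ω) (v : Eu d → ℝ) (e : Set (Eu d)) : ℝ :=
  open scoped Classical in
  ∑ p : Fin M.card × FacetIdx d K with M.facet p.1 p.2 = e,
    ∫ x in M.cell p.1, ‖M.brokenGrad v x‖ ^ 2

theorem setIntegral_cell_le_facetEnergy (v : Eu d → ℝ) {T : Fin M.card} {k : FacetIdx d K}
    (h : M.facet T k = e) : ∫ x in M.cell T, ‖M.brokenGrad v x‖ ^ 2 ≤ M.facetEnergy v e := by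
  classical
  exact Finset.single_le_sum (f := fun p : Fin M.card × FacetIdx d K =>
    ∫ x in M.cell p.1, ‖M.brokenGrad v x‖ ^ 2)
    (fun _ _ => integral_nonneg fun _ => sq_nonneg _)
    (Finset.mem_filter.2 ⟨Finset.mem_univ (T, k), h⟩)

theorem facetEnergy_nonneg (v : Eu d → ℝ) (e : Set (Eu d)) : 0 ≤ M.facetEnergy v e :=
  Finset.sum_nonneg fun _ _ => integral_nonneg fun _ => sq_nonneg _

/-- Each pair of an element and a facet label produces exactly one face, so each element is counted
once per label. -/
theorem sum_facetEnergy (v : Eu d → ℝ) : ∑ e ∈ M.faces, M.facetEnergy v e =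
    Fintype.card (FacetIdx d K) * ∑ T, ∫ x in M.cell T, ‖M.brokenGrad v x‖ ^ 2 := by
  classical
  have h := Finset.sum_fiberwise_of_maps_to (s := Finset.univ) (t := M.faces)
    (g := fun p : Fin M.card × FacetIdx d K => M.facet p.1 p.2)
    (fun p hp => Finset.mem_image_of_mem _ hp)
    (fun p => ∫ x in M.cell p.1, ‖M.brokenGrad v x‖ ^ 2)
  rw [Fintype.sum_prod_type] at h
  simp only [Finset.sum_const, Finset.card_univ, nsmul_eq_mul, ← Finset.mul_sum] at h
  rw [← h]
  refine Finset.sum_congr rfl fun e _ => ?_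
  rw [facetEnergy]

/-- On each side of the face, `h_e ≤ h_T` and `|A∇v| ≤ β|∇v|` reduce the claim to the trace
inequality. -/
theorem diam_mul_integral_avgFlux_sq_le (hM : M.ShapeRegular κ) (hd : d ≠ 0) (hα : 0 < α)
    (hβ : 0 < β) (hA : M.IsDiffusion A α β) {C : ℝ} (hC : 0 ≤ C)
    (htrace : ∀ T k, Metric.diam (M.elem T) *
        ∫ x in M.facet T k, ‖M.traceFrom T (M.brokenGrad v) x‖ ^ 2 ∂μHE[d - 1] ≤
      C * ∫ x in M.cell T, ‖M.brokenGrad v x‖ ^ 2)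
    (he : e ∈ M.faces) (hv : v ∈ M.space 1) :
    Metric.diam e * ∫ x in e, M.avgFlux A v e x ^ 2 ∂μHE[d - 1] ≤
      β ^ 2 * C * M.facetEnergy v e := by
  have hcompact := isCompact_of_mem_faces hd he
  have hside : ∀ T k, M.facet T k = e →
      IntegrableOn (fun x => ‖M.traceFrom T (M.brokenGrad v) x‖ ^ 2) e μHE[d - 1] ∧
      Metric.diam e * ∫ x in e, ‖M.traceFrom T (M.brokenGrad v) x‖ ^ 2 ∂μHE[d - 1] ≤
        C * M.facetEnergy v e ∧
      ∀ x ∈ e, inner ℝ (M.normal e) (M.traceFrom T (fun y => A y (M.brokenGrad v y)) x) ^ 2 ≤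
        β ^ 2 * ‖M.traceFrom T (M.brokenGrad v) x‖ ^ 2 := by
    intro T k hk
    have hsub : e ⊆ M.elem T := hk ▸ M.facet_subset_elem hd T k
    refine ⟨integrableOn_of_mem_faces hM hd he
      (((hasContExt_brokenGrad hM hd hv T).continuousOn_traceFrom.mono hsub).norm.pow 2), ?_, ?_⟩
    · have h1 := htrace T k
      rw [hk] at h1
      have h2 : Metric.diam e ≤ Metric.diam (M.elem T) :=
        Metric.diam_mono hsub (M.isCompact_elem T).isBounded
      have h3 : 0 ≤ ∫ x in e, ‖M.traceFrom T (M.brokenGrad v) x‖ ^ 2 ∂μHE[d - 1] :=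
        integral_nonneg fun _ => sq_nonneg _
      calc _ ≤ _ := mul_le_mul_of_nonneg_right h2 h3
        _ ≤ _ := h1
        _ ≤ _ := mul_le_mul_of_nonneg_left (setIntegral_cell_le_facetEnergy v hk) hC
    · intro x hx
      rw [← mul_pow, ← sq_abs]
      gcongr
      calc _ ≤ ‖M.normal e‖ * ‖M.traceFrom T (fun y => A y (M.brokenGrad v y)) x‖ :=
            abs_real_inner_le_norm _ _
        _ ≤ _ := by
            rw [norm_normal he, one_mul]
            exact norm_traceFrom_flux_le hM hd hα hβ hA hv (hsub hx)
  have hflux : IntegrableOn (fun x => M.avgFlux A v e x ^ 2) e μHE[d - 1] :=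
    integrableOn_of_mem_faces hM hd he ((continuousOn_avgFlux hM hd hA he hv).pow 2)
  obtain ⟨k, hk⟩ := exists_facet_minus he
  obtain ⟨hi1, hb1, hp1⟩ := hside _ k hk
  have hdiam : 0 ≤ Metric.diam e := Metric.diam_nonneg
  by_cases hint : M.IsInterior e
  · obtain ⟨l, hl⟩ := hint.exists_facet_plus
    obtain ⟨hi2, hb2, hp2⟩ := hside _ l hl
    have hle : ∫ x in e, M.avgFlux A v e x ^ 2 ∂μHE[d - 1] ≤
        ∫ x in e, (β ^ 2 / 2 * ‖M.traceFrom (M.minus e) (M.brokenGrad v) x‖ ^ 2 +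
          β ^ 2 / 2 * ‖M.traceFrom (M.plus e) (M.brokenGrad v) x‖ ^ 2) ∂μHE[d - 1] := by
      refine setIntegral_mono_on hflux ((hi1.const_mul _).add (hi2.const_mul _))
        hcompact.measurableSet fun x hx => ?_
      have h1 := hp1 x hx
      have h2 := hp2 x hx
      simp only [avgFlux, if_pos hint]
      set a := (inner ℝ (M.normal e)
        (M.traceFrom (M.minus e) (fun y => A y (M.brokenGrad v y)) x) : ℝ)
      set b := (inner ℝ (M.normal e)
        (M.traceFrom (M.plus e) (fun y => A y (M.brokenGrad v y)) x) : ℝ)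
      -- By convexity of the square, the two sides enter with weight one half each, and no factor is
      -- lost against the boundary case.
      have h3 : ((a + b) / 2) ^ 2 ≤ (a ^ 2 + b ^ 2) / 2 := by nlinarith [sq_nonneg (a - b)]
      linarith
    rw [integral_add (hi1.const_mul _) (hi2.const_mul _), integral_const_mul,
      integral_const_mul] at hle
    have h4 := mul_le_mul_of_nonneg_left hle hdiam
    have h5 := mul_le_mul_of_nonneg_left hb1 (by positivity : 0 ≤ β ^ 2 / 2)
    have h6 := mul_le_mul_of_nonneg_left hb2 (by positivity : 0 ≤ β ^ 2 / 2)
    linarith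
  · have hle : ∫ x in e, M.avgFlux A v e x ^ 2 ∂μHE[d - 1] ≤
        ∫ x in e, β ^ 2 * ‖M.traceFrom (M.minus e) (M.brokenGrad v) x‖ ^ 2 ∂μHE[d - 1] := by
      refine setIntegral_mono_on hflux (hi1.const_mul _) hcompact.measurableSet fun x hx => ?_
      simp only [avgFlux, if_neg hint]
      exact hp1 x hx
    rw [integral_const_mul] at hle
    have h4 := mul_le_mul_of_nonneg_left hle hdiam
    have h5 := mul_le_mul_of_nonneg_left hb1 (by positivity : 0 ≤ β ^ 2)
    linarith

theorem abs_integral_avgFlux_mul_jump_le (hM : M.ShapeRegular κ) (hd : 2 ≤ d) (hα : 0 < α)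
    (hβ : 0 < β) (hA : M.IsDiffusion A α β) {C : ℝ} (hC : 0 ≤ C)
    (htrace : ∀ T k, Metric.diam (M.elem T) *
        ∫ x in M.facet T k, ‖M.traceFrom T (M.brokenGrad v) x‖ ^ 2 ∂μHE[d - 1] ≤
      C * ∫ x in M.cell T, ‖M.brokenGrad v x‖ ^ 2)
    (he : e ∈ M.faces) (hv : v ∈ M.space 1) (hw : w ∈ M.space 1) {σ s : ℝ} (hσ : 0 < σ)
    (hs : 0 < s) :
    |∫ x in e, M.avgFlux A v e x * M.jump w e x ∂μHE[d - 1]| ≤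
      (s * (β ^ 2 * C / σ * M.facetEnergy v e) +
        s⁻¹ * (σ / Metric.diam e * ∫ x in e, M.jump w e x ^ 2 ∂μHE[d - 1])) / 2 := by
  have hd0 : d ≠ 0 := by omega
  rcases (Metric.diam_nonneg (s := e)).eq_or_lt with h0 | hpos
  · have hE := facetEnergy_nonneg (M := M) v e
    rw [restrict_eq_zero_of_diam_eq_zero hd he h0.symm]
    simp only [integral_zero_measure, abs_zero]
    rw [mul_zero, mul_zero, add_zero]
    positivity
  · have hy := abs_integral_mul_le
      (integrableOn_of_mem_faces hM hd0 he ((continuousOn_avgFlux hM hd0 hA he hv).pow 2))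
      (integrableOn_of_mem_faces hM hd0 he ((continuousOn_jump hM hd0 he hw).pow 2))
      -- This weight gives the jump the coefficient `s⁻¹ σ / h_e` of the energy norm and leaves
      -- `h_e` with the flux, as the trace inequality requires.
      (c := s * (Metric.diam e / σ)) (by positivity)
    refine hy.trans ?_
    have hb := diam_mul_integral_avgFlux_sq_le hM hd0 hα hβ hA hC htrace he hv
    rw [mul_inv, inv_div, mul_assoc s, mul_assoc s⁻¹]
    have hdiv := mul_le_mul_of_nonneg_left (div_le_div_of_nonneg_right hb hσ.le) hs.le
    rw [mul_div_right_comm, mul_div_right_comm] at hdiv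
    linarith

theorem energyNorm_sq (hα : 0 < α) (hA : M.IsDiffusion A α β) {ΓD : Set (Eu d)} {σ : ℝ}
    (hσ : 0 < σ) (v : Eu d → ℝ) : M.energyNorm ΓD A σ v ^ 2 =
      (∫ x in Ω, inner ℝ (A x (M.brokenGrad v x)) (M.brokenGrad v x)) +
        ∑ e ∈ M.dgFaces ΓD, σ / Metric.diam e * ∫ x in e, M.jump v e x ^ 2 ∂μHE[d - 1] := by
  refine Real.sq_sqrt (add_nonneg (integral_nonneg_of_ae ?_) (Finset.sum_nonneg fun e _ => ?_))
  · filter_upwards [hA.bounds] with x hx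
    exact le_trans (by positivity) (hx _).1
  · exact mul_nonneg (div_nonneg hσ.le Metric.diam_nonneg) (integral_nonneg fun _ => sq_nonneg _)

theorem sum_facetEnergy_le (hM : M.ShapeRegular κ) (hd : d ≠ 0) (hΩ : MeasurableSet Ω)
    (hA : M.IsDiffusion A α β) (hv : v ∈ M.space 1) (ΓD : Set (Eu d)) (hα : 0 < α) :
    α * ∑ e ∈ M.dgFaces ΓD, M.facetEnergy v e ≤ Fintype.card (FacetIdx d K) *
      ∫ x in Ω, inner ℝ (A x (M.brokenGrad v x)) (M.brokenGrad v x) := by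
  classical
  have h1 : ∑ e ∈ M.dgFaces ΓD, M.facetEnergy v e ≤ ∑ e ∈ M.faces, M.facetEnergy v e :=
    Finset.sum_le_sum_of_subset_of_nonneg (Finset.filter_subset _ _)
      fun e _ _ => facetEnergy_nonneg v e
  have hzero : ∀ x ∉ ⋃ T, M.cell T, ‖M.brokenGrad v x‖ ^ 2 = 0 := fun x hx => by
    simp [M.brokenGrad_of_notMem v hx]
  have hext := hasContExt_norm_sq_brokenGrad hM hd hv
  rw [sum_facetEnergy, ← setIntegral_eq_sum_cell hM hd hΩ hext hzero] at h1
  have h2 : α * ∫ x in Ω, ‖M.brokenGrad v x‖ ^ 2 ≤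
      ∫ x in Ω, inner ℝ (A x (M.brokenGrad v x)) (M.brokenGrad v x) := by
    rw [← integral_const_mul]
    refine integral_mono_ae ((integrableOn_of_hasContExt hM hd hΩ hext hzero).const_mul α)
      (integrableOn_inner_flux hM hd hΩ hA hv hv) ?_
    filter_upwards [hA.bounds] with x hx
    exact (hx _).1
  calc _ ≤ α * (Fintype.card (FacetIdx d K) * ∫ x in Ω, ‖M.brokenGrad v x‖ ^ 2) :=
        mul_le_mul_of_nonneg_left h1 hα.le
    _ = Fintype.card (FacetIdx d K) * (α * ∫ x in Ω, ‖M.brokenGrad v x‖ ^ 2) := by ring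
    _ ≤ _ := mul_le_mul_of_nonneg_left h2 (Nat.cast_nonneg _)

/-- Here the lower bound on the penalty removes `α` and `β` from the constant: only `C` and the
number of facets of an element remain. -/
theorem sum_abs_integral_avgFlux_mul_jump_le (hM : M.ShapeRegular κ) (hd : 2 ≤ d)
    (hΩ : MeasurableSet Ω) (hα : 0 < α) (hβ : 0 < β) (hA : M.IsDiffusion A α β) {C : ℝ}
    (hC : 0 ≤ C)
    (htrace : ∀ T k, Metric.diam (M.elem T) *
        ∫ x in M.facet T k, ‖M.traceFrom T (M.brokenGrad v) x‖ ^ 2 ∂μHE[d - 1] ≤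
      C * ∫ x in M.cell T, ‖M.brokenGrad v x‖ ^ 2)
    (hv : v ∈ M.space 1) (hw : w ∈ M.space 1) (ΓD : Set (Eu d)) {σ s : ℝ} (hσ : β ^ 2 / α ≤ σ)
    (hs : 0 < s) :
    ∑ e ∈ M.dgFaces ΓD, |∫ x in e, M.avgFlux A v e x * M.jump w e x ∂μHE[d - 1]| ≤
      (s * (C * Fintype.card (FacetIdx d K) *
          ∫ x in Ω, inner ℝ (A x (M.brokenGrad v x)) (M.brokenGrad v x)) +
        s⁻¹ * ∑ e ∈ M.dgFaces ΓD,
          σ / Metric.diam e * ∫ x in e, M.jump w e x ^ 2 ∂μHE[d - 1]) / 2 := by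
  have hσ0 : 0 < σ := lt_of_lt_of_le (by positivity) hσ
  have h1 := Finset.sum_le_sum fun e he => abs_integral_avgFlux_mul_jump_le hM hd hα hβ hA hC htrace
    (mem_faces_of_mem_dgFaces (ΓD := ΓD) he) hv hw hσ0 hs
  refine h1.trans ?_
  rw [← Finset.sum_div, Finset.sum_add_distrib, ← Finset.mul_sum, ← Finset.mul_sum,
    ← Finset.mul_sum]
  have h2 := sum_facetEnergy_le hM (by omega) hΩ hA hv ΓD hα
  have h3 : 0 ≤ ∑ e ∈ M.dgFaces ΓD, M.facetEnergy v e :=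
    Finset.sum_nonneg fun e _ => facetEnergy_nonneg v e
  -- The factor `β²` comes from the flux bound, and `α` is what the energy can absorb.
  have h4 : β ^ 2 / σ ≤ α := by
    rw [div_le_iff₀ hα] at hσ
    rw [div_le_iff₀ hσ0]
    linarith
  have h5 : β ^ 2 * C / σ * ∑ e ∈ M.dgFaces ΓD, M.facetEnergy v e ≤
      C * Fintype.card (FacetIdx d K) *
        ∫ x in Ω, inner ℝ (A x (M.brokenGrad v x)) (M.brokenGrad v x) := by
    calc β ^ 2 * C / σ * ∑ e ∈ M.dgFaces ΓD, M.facetEnergy v e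
        = C * (β ^ 2 / σ * ∑ e ∈ M.dgFaces ΓD, M.facetEnergy v e) := by ring
      _ ≤ C * (α * ∑ e ∈ M.dgFaces ΓD, M.facetEnergy v e) := by gcongr
      _ ≤ C * (Fintype.card (FacetIdx d K) *
            ∫ x in Ω, inner ℝ (A x (M.brokenGrad v x)) (M.brokenGrad v x)) := by gcongr
      _ = _ := by ring
  have h6 := mul_le_mul_of_nonneg_left h5 hs.le
  linarith

theorem abs_penalty_le (hM : M.ShapeRegular κ) (hd : d ≠ 0) (hv : v ∈ M.space 1)
    (hw : w ∈ M.space 1) (he : e ∈ M.faces) {σ s : ℝ} (hσ : 0 < σ) (hs : 0 < s) :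
    |σ / Metric.diam e * ∫ x in e, M.jump v e x * M.jump w e x ∂μHE[d - 1]| ≤
      (s * (σ / Metric.diam e * ∫ x in e, M.jump v e x ^ 2 ∂μHE[d - 1]) +
        s⁻¹ * (σ / Metric.diam e * ∫ x in e, M.jump w e x ^ 2 ∂μHE[d - 1])) / 2 := by
  have h0 : 0 ≤ σ / Metric.diam e := div_nonneg hσ.le Metric.diam_nonneg
  have hy := abs_integral_mul_le
    (integrableOn_of_mem_faces hM hd he ((continuousOn_jump hM hd he hv).pow 2))
    (integrableOn_of_mem_faces hM hd he ((continuousOn_jump hM hd he hw).pow 2)) hs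
  rw [abs_mul, abs_of_nonneg h0]
  refine (mul_le_mul_of_nonneg_left hy h0).trans_eq ?_
  ring

theorem abs_integral_inner_flux_le (hM : M.ShapeRegular κ) (hd : d ≠ 0) (hΩ : MeasurableSet Ω)
    (hα : 0 < α) (hA : M.IsDiffusion A α β) (hv : v ∈ M.space 1) (hw : w ∈ M.space 1) {s : ℝ}
    (hs : 0 < s) :
    |∫ x in Ω, (inner ℝ (A x (M.brokenGrad v x)) (M.brokenGrad w x) : ℝ)| ≤
      (s * (∫ x in Ω, inner ℝ (A x (M.brokenGrad v x)) (M.brokenGrad v x)) +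
        s⁻¹ * ∫ x in Ω, inner ℝ (A x (M.brokenGrad w x)) (M.brokenGrad w x)) / 2 := by
  have hvv := integrableOn_inner_flux hM hd hΩ hA hv hv
  have hww := integrableOn_inner_flux hM hd hΩ hA hw hw
  rw [← integral_const_mul, ← integral_const_mul, ← integral_add (hvv.const_mul s)
    (hww.const_mul s⁻¹), ← integral_div, ← Real.norm_eq_abs]
  refine norm_integral_le_of_norm_le (((hvv.const_mul s).add (hww.const_mul s⁻¹)).div_const 2) ?_
  filter_upwards [hA.symm, hA.bounds] with x hsymm hb
  exact abs_inner_le_of_nonneg hsymm (fun u => le_trans (by positivity) (hb u).1) hs _ _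

/-- The optimal weight is `y / x`. Replacing `x, y` by `x + ε, y + ε` keeps it positive and finite,
and then `ε → 0`. -/
theorem le_mul_of_forall_weights {a C x y : ℝ} (hC : 0 ≤ C) (hx : 0 ≤ x) (hy : 0 ≤ y)
    (h : ∀ s : ℝ, 0 < s → a ≤ C * (s * x ^ 2 + s⁻¹ * y ^ 2) / 2) : a ≤ C * (x * y) := by
  have key : ∀ ε : ℝ, 0 < ε → a ≤ C * ((x + ε) * (y + ε)) := by
    intro ε hε
    have h1 := h ((y + ε) / (x + ε)) (by positivity)
    have h2 : (y + ε) / (x + ε) * x ^ 2 ≤ (x + ε) * (y + ε) := by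
      rw [div_mul_eq_mul_div, div_le_iff₀ (by positivity)]
      calc (y + ε) * x ^ 2 ≤ (y + ε) * (x + ε) ^ 2 := by gcongr; linarith
        _ = _ := by ring
    have h3 : ((y + ε) / (x + ε))⁻¹ * y ^ 2 ≤ (x + ε) * (y + ε) := by
      rw [inv_div, div_mul_eq_mul_div, div_le_iff₀ (by positivity)]
      calc (x + ε) * y ^ 2 ≤ (x + ε) * (y + ε) ^ 2 := by gcongr; linarith
        _ = _ := by ring
    have h4 := mul_le_mul_of_nonneg_left (add_le_add h2 h3) hC
    linarith
  have hlim : Tendsto (fun ε : ℝ => C * ((x + ε) * (y + ε))) (𝓝[>] 0) (𝓝 (C * (x * y))) := by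
    have : Tendsto (fun ε : ℝ => C * ((x + ε) * (y + ε))) (𝓝 0)
        (𝓝 (C * ((x + 0) * (y + 0)))) := Continuous.tendsto (by fun_prop) _
    simpa using this.mono_left nhdsWithin_le_nhds
  refine ge_of_tendsto hlim ?_
  filter_upwards [self_mem_nhdsWithin] with ε hε
  exact key ε hε

theorem exists_abs_form_le (hd : 2 ≤ d) (K : RefKind) (κ : ℝ) : ∃ C : ℝ, 0 ≤ C ∧
    ∀ α β : ℝ, 0 < α → 0 < β → ∀ (Ω ΓD : Set (Eu d)), MeasurableSet Ω → ∀ M : Mesh K Ω,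
      M.ShapeRegular κ → ∀ A : Eu d → Eu d →L[ℝ] Eu d, M.IsDiffusion A α β →
      ∀ σ : ℝ, β ^ 2 / α ≤ σ → ∀ v ∈ M.space 1, ∀ w ∈ M.space 1,
        |M.form ΓD A σ v w| ≤ C * (M.energyNorm ΓD A σ v * M.energyNorm ΓD A σ w) := by
  have hd0 : d ≠ 0 := by omega
  obtain ⟨C, hC, htrace⟩ := exists_trace_inequality hd0 K κ
  -- The four terms together contribute `1 + D` times each volume energy and `2` times each jump
  -- energy, with `D` the product of `C` and the number of facets; `2 + D` dominates both
  -- coefficients.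
  refine ⟨2 + C * Fintype.card (FacetIdx d K), by positivity, ?_⟩
  intro α β hα hβ Ω ΓD hΩ M hM A hA σ hσ v hv w hw
  have hσ0 : 0 < σ := lt_of_lt_of_le (by positivity) hσ
  refine le_mul_of_forall_weights (by positivity) (Real.sqrt_nonneg _) (Real.sqrt_nonneg _)
    fun s hs => ?_
  rw [energyNorm_sq hα hA hσ0, energyNorm_sq hα hA hσ0]
  have h1 := abs_integral_inner_flux_le hM hd0 hΩ hα hA hv hw hs
  have h2 := sum_abs_integral_avgFlux_mul_jump_le hM hd hΩ hα hβ hA hC (htrace Ω M hM v hv) hv hw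
    ΓD hσ hs
  -- The roles of `v` and `w` are exchanged, so the inverse weight is used: all terms in `v` then
  -- carry `s` and all terms in `w` carry `s⁻¹`.
  have h3 := sum_abs_integral_avgFlux_mul_jump_le hM hd hΩ hα hβ hA hC (htrace Ω M hM w hw) hw hv
    ΓD hσ (inv_pos.2 hs)
  have h4 := Finset.sum_le_sum fun e he => abs_penalty_le hM hd0 hv hw
    (mem_faces_of_mem_dgFaces (ΓD := ΓD) he) hσ0 hs
  rw [← Finset.sum_div, Finset.sum_add_distrib, ← Finset.mul_sum, ← Finset.mul_sum] at h4
  rw [inv_inv] at h3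
  have hEv : 0 ≤ ∫ x in Ω, (inner ℝ (A x (M.brokenGrad v x)) (M.brokenGrad v x) : ℝ) := by
    refine integral_nonneg_of_ae ?_
    filter_upwards [hA.bounds] with x hx
    exact le_trans (by positivity) (hx _).1
  have hEw : 0 ≤ ∫ x in Ω, (inner ℝ (A x (M.brokenGrad w x)) (M.brokenGrad w x) : ℝ) := by
    refine integral_nonneg_of_ae ?_
    filter_upwards [hA.bounds] with x hx
    exact le_trans (by positivity) (hx _).1
  have hJ : ∀ u : Eu d → ℝ, 0 ≤ ∑ e ∈ M.dgFaces ΓD,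
      σ / Metric.diam e * ∫ x in e, M.jump u e x ^ 2 ∂μHE[d - 1] := fun u =>
    Finset.sum_nonneg fun e _ => mul_nonneg (div_nonneg hσ0.le Metric.diam_nonneg)
      (integral_nonneg fun _ => sq_nonneg _)
  have hJv := hJ v
  have hJw := hJ w
  have hform : |M.form ΓD A σ v w| ≤
      |∫ x in Ω, (inner ℝ (A x (M.brokenGrad v x)) (M.brokenGrad w x) : ℝ)| +
      (∑ e ∈ M.dgFaces ΓD, |∫ x in e, M.avgFlux A v e x * M.jump w e x ∂μHE[d - 1]| +
        ∑ e ∈ M.dgFaces ΓD, |∫ x in e, M.avgFlux A w e x * M.jump v e x ∂μHE[d - 1]| +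
        ∑ e ∈ M.dgFaces ΓD,
          |σ / Metric.diam e * ∫ x in e, M.jump v e x * M.jump w e x ∂μHE[d - 1]|) := by
    rw [form, ← Finset.sum_add_distrib, ← Finset.sum_add_distrib]
    refine (abs_sub _ _).trans (add_le_add_right ((Finset.abs_sum_le_sum_abs _ _).trans
      (Finset.sum_le_sum fun e _ => ?_)) _)
    exact (abs_sub _ _).trans (add_le_add_left (abs_add_le _ _) _)
  set Ev := ∫ x in Ω, (inner ℝ (A x (M.brokenGrad v x)) (M.brokenGrad v x) : ℝ)
  set Ew := ∫ x in Ω, (inner ℝ (A x (M.brokenGrad w x)) (M.brokenGrad w x) : ℝ)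
  set Jv := ∑ e ∈ M.dgFaces ΓD, σ / Metric.diam e * ∫ x in e, M.jump v e x ^ 2 ∂μHE[d - 1]
  set Jw := ∑ e ∈ M.dgFaces ΓD, σ / Metric.diam e * ∫ x in e, M.jump w e x ^ 2 ∂μHE[d - 1]
  set D := C * (Fintype.card (FacetIdx d K) : ℝ)
  have hD : 0 ≤ D := by positivity
  have hs' : 0 ≤ s⁻¹ := inv_nonneg.2 hs.le
  -- The slack between the exact coefficients and `2 + D`.
  have p1 : 0 ≤ s * (Ev + D * Jv) := by positivity
  have p2 : 0 ≤ s⁻¹ * (Ew + D * Jw) := by positivity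
  linarith

end Bounded

end Mesh

/-! ### The multiscale space -/

section Multiscale

variable {d : ℕ} {K : RefKind} {Ω : Set (Eu d)} {κ : ℝ}

/-- An affine map that takes the reference element into itself injectively takes interior points
to interior points. -/
theorem mapsTo_interior_refElem {S : Eu d →ᵃ[ℝ] Eu d}
    (hS : MapsTo S (refElem d K) (refElem d K)) (hinj : InjOn S (refElem d K)) :
    MapsTo S (interior (refElem d K)) (interior (refElem d K)) := by
  obtain ⟨x₀, hx₀⟩ := interior_refElem_nonempty d K
  have hlin : Function.Injective S.linear := by
    rw [← LinearMap.ker_eq_bot, LinearMap.ker_eq_bot']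
    intro ξ hξ
    -- A kernel direction of the linear part would make `S` constant on a short segment inside the
    -- reference element.
    by_contra hne
    have htend : Tendsto (fun t : ℝ => x₀ + t • ξ) (𝓝[>] 0) (𝓝 x₀) := by
      have : Tendsto (fun t : ℝ => x₀ + t • ξ) (𝓝 0) (𝓝 (x₀ + (0 : ℝ) • ξ)) :=
        Continuous.tendsto (by fun_prop) _
      simpa using this.mono_left nhdsWithin_le_nhds
    obtain ⟨t, ht, ht0⟩ := ((htend.eventually (mem_interior_iff_mem_nhds.1 hx₀)).and
      self_mem_nhdsWithin).exists
    have heq : S (x₀ + t • ξ) = S x₀ := by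
      rw [add_comm, ← vadd_eq_add, S.map_vadd, map_smul, hξ, smul_zero, zero_vadd]
    have := hinj ht (interior_subset hx₀) heq
    rw [add_eq_left, smul_eq_zero] at this
    exact this.elim (ne_of_gt ht0) hne
  have hopen : IsOpenMap S := S.isOpenMap_linear_iff.1
    (S.linear.isOpenMap_of_finiteDimensional (LinearMap.injective_iff_surjective.1 hlin))
  intro x hx
  refine mem_interior.2 ⟨S '' interior (refElem d K), ?_, hopen _ isOpen_interior, x, hx, rfl⟩
  rintro _ ⟨z, hz, rfl⟩
  exact hS (interior_subset hz)

theorem affineMap_apply_eq_sum (S : Eu d →ᵃ[ℝ] Eu d) (x : Eu d) (i : Fin d) :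
    S x i = S 0 i + ∑ j, S.linear (EuclideanSpace.single j 1) i * x j := by
  have h : S x = S.linear x + S 0 := by
    have := S.map_vadd 0 x
    simpa using this
  have hx : x = ∑ j, x j • EuclideanSpace.single j (1 : ℝ) := by
    ext k
    simp [Finset.sum_apply, Pi.single_apply]
  have hlin : S.linear x i = ∑ j, S.linear (EuclideanSpace.single j 1) i * x j := by
    conv_lhs => rw [hx]
    simp [mul_comm]
  rw [h, PiLp.add_apply, hlin, add_comm]

/-- Affine substitution preserves total degree at most one, which settles simplices. On cubes a
general affine map would raise the degree in a variable; here each coordinate of `S` involves a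
single variable, and as `π` is a permutation each variable occurs in only one factor of the product.
-/
theorem exists_refPoly_refLagrange_comp {S : Eu d →ᵃ[ℝ] Eu d}
    (hcube : K = .cube → ∃ π : Equiv.Perm (Fin d), ∀ i, ∃ a b : ℝ, ∀ x, S x i = a + b * x (π i))
    (j : VertexIdx d K) : ∃ q ∈ refPoly d K 1, ∀ x, refLagrange d K j (S x) = evalAt x q := by
  match K, j with
  | .simplex, j =>
    have hcoord : ∀ i, ∃ q ∈ refPoly d .simplex 1, ∀ x, S x i = evalAt x q := by
      intro i
      refine ⟨MvPolynomial.C (S 0 i) + ∑ j, MvPolynomial.C (S.linear (EuclideanSpace.single j 1) i) *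
        MvPolynomial.X j, ?_, fun x => ?_⟩
      · refine Submodule.add_mem _ ?_ (Submodule.sum_mem _ fun j _ => ?_)
        · exact (MvPolynomial.mem_restrictTotalDegree _ _ _).2 (by simp)
        · refine (MvPolynomial.mem_restrictTotalDegree _ _ _).2 ?_
          exact (MvPolynomial.totalDegree_mul _ _).trans (by simp)
      · rw [affineMap_apply_eq_sum]
        simp [evalAt]
    match j with
    | some i => exact hcoord i
    | none =>
      choose q hq hqx using hcoord
      refine ⟨1 - ∑ i, q i, Submodule.sub_mem _ ?_ (Submodule.sum_mem _ fun i _ => hq i),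
        fun x => ?_⟩
      · exact (MvPolynomial.mem_restrictTotalDegree _ _ _).2 (by simp)
      · simp [refLagrange, evalAt, hqx]
  | .cube, c =>
    obtain ⟨π, hπ⟩ := hcube rfl
    choose a b hab using hπ
    let r : Fin d → MvPolynomial (Fin d) ℝ := fun i =>
      if (c : Fin d → Bool) i = true then
        MvPolynomial.C (a i) + MvPolynomial.C (b i) * MvPolynomial.X (π i)
      else MvPolynomial.C (1 - a i) + MvPolynomial.C (-b i) * MvPolynomial.X (π i)
    have hlin : ∀ (k i : Fin d) (s t : ℝ), MvPolynomial.degreeOf k (MvPolynomial.C s +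
        MvPolynomial.C t * MvPolynomial.X (π i) : MvPolynomial (Fin d) ℝ) ≤
          if k = π i then 1 else 0 := by
      intro k i s t
      refine (MvPolynomial.degreeOf_add_le _ _ _).trans ?_
      rw [MvPolynomial.degreeOf_C, Nat.max_eq_right (Nat.zero_le _)]
      refine (MvPolynomial.degreeOf_C_mul_le _ _ _).trans ?_
      rw [MvPolynomial.degreeOf_X]
    have hr : ∀ k i, MvPolynomial.degreeOf k (r i) ≤ if k = π i then 1 else 0 := by
      intro k i
      by_cases hc : (c : Fin d → Bool) i = true
      · simpa only [r, if_pos hc] using hlin k i _ _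
      · simpa only [r, if_neg hc] using hlin k i _ _
    refine ⟨∏ i, r i, ?_, fun x => ?_⟩
    · refine (MvPolynomial.mem_restrictDegree_iff_sup _ _ _).2 fun k => ?_
      have h1 : MvPolynomial.degreeOf k (∏ i, r i) ≤ 1 := by
        refine (MvPolynomial.degreeOf_prod_le _ _ _).trans
          ((Finset.sum_le_sum fun i _ => hr k i).trans ?_)
        have : ∀ i, (k = π i) = (i = π.symm k) := fun i => by
          rw [Equiv.eq_symm_apply, @eq_comm _ k]
        simp [this]
      rwa [MvPolynomial.degreeOf_def] at h1
    · simp only [refLagrange, evalAt, map_prod]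
      refine Finset.prod_congr rfl fun i _ => ?_
      by_cases hc : (c : Fin d → Bool) i = true
      · simp [r, hc, hab]
      · simp only [r, hc, hab]
        simp
        ring

/-- Each fine cell lies in one coarse cell. There the basis function is the reference one composed
with `S`, or it vanishes because distinct coarse cells are disjoint. -/
theorem lagrange_mem_space {MH Mh : Mesh K Ω} (hd : d ≠ 0) (href : MH.IsRefinedBy Mh)
    (T : Fin MH.card) (j : VertexIdx d K) : MH.lagrange T j ∈ Mh.space 1 := by
  intro t
  obtain ⟨T', S, hS, hcube, hmap⟩ := href t
  have hinj : InjOn S (refElem d K) := fun x hx y hy hxy =>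
    Mh.map_inj t hx hy (by rw [hmap x hx, hmap y hy, hxy])
  have hSint := mapsTo_interior_refElem hS hinj
  by_cases hT : T' = T
  · subst hT
    obtain ⟨q, hq, hqx⟩ := exists_refPoly_refLagrange_comp hcube j
    refine ⟨q, hq, fun x hx => ?_⟩
    rw [hmap x (interior_subset hx), Mesh.lagrange, if_pos (show _ ∈ MH.cell T' from mem_image_of_mem _ (hSint hx)),
      (MH.map_inj T').leftInvOn_invFunOn (interior_subset (hSint hx)), hqx]
  · refine ⟨0, Submodule.zero_mem _, fun x hx => ?_⟩
    rw [hmap x (interior_subset hx), Mesh.lagrange, if_neg]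
    · simp [evalAt]
    · exact Set.disjoint_left.1 (MH.disjoint_cell hd hT) (mem_image_of_mem _ (hSint hx))

/-- Conformity of the multiscale space, from which Galerkin orthogonality follows. Of the
correctors, only their membership in the fine space matters. -/
theorem msSpace_le {MH Mh : Mesh K Ω} (hd : d ≠ 0) (href : MH.IsRefinedBy Mh) {ΓD : Set (Eu d)}
    {A : Eu d → Eu d →L[ℝ] Eu d} {σ : ℝ} {L : ℕ}
    {φ : Fin MH.card → VertexIdx d K → Eu d → ℝ} (hφ : AreCorrectors MH Mh ΓD A σ L φ) :
    msSpace MH φ ≤ Mh.space 1 := by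
  refine Submodule.span_le.2 ?_
  rintro _ ⟨⟨T, j⟩, rfl⟩
  exact Submodule.sub_mem _ (lagrange_mem_space hd href T j) (hφ T j).1.1.1

/-- The error of a Galerkin approximation in a functional is the form applied to the errors of the
primal and the dual approximation. -/
theorem functional_sub_eq_form {M : Mesh K Ω} (hM : M.ShapeRegular κ) (hd : d ≠ 0)
    (hΩ : MeasurableSet Ω) {A : Eu d → Eu d →L[ℝ] Eu d} {α β : ℝ} (hA : M.IsDiffusion A α β)
    {ΓD : Set (Eu d)} {σ : ℝ} {V : Submodule ℝ (Eu d → ℝ)} (hV : V ≤ M.space 1)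
    {f g u uV φ φV : Eu d → ℝ} (hu : IsGalerkin M ΓD A σ f (M.space 1) u)
    (huV : IsGalerkin M ΓD A σ f V uV) (hφ : IsDualGalerkin M ΓD A σ g (M.space 1) φ)
    (hφV : IsDualGalerkin M ΓD A σ g V φV) :
    functional Ω g u - functional Ω g uV = M.form ΓD A σ (u - uV) (φ - φV) := by
  have huV' := hV huV.1
  have hφV' := hV hφV.1
  -- In the expansion, the pairings with `φ` give the functional at `u` and at `uV`. Those with `φV`
  -- both equal the load `f` tested with `φV` and cancel.
  rw [Mesh.form_sub_right hM hd hΩ hA ΓD σ hφ.1 hφV' (Submodule.sub_mem _ hu.1 huV'),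
    Mesh.form_sub_left hM hd hΩ hA ΓD σ hu.1 huV' hφ.1,
    Mesh.form_sub_left hM hd hΩ hA ΓD σ hu.1 huV' hφV', hφ.2 u hu.1, hφ.2 uV huV',
    hu.2 φV hφV', huV.2 φV hφV.1, sub_self, sub_zero]

end Multiscale

end DGMultiscale

end

/-! ### The error estimate in the quantity of interest -/

open MeasureTheory DGMultiscale in
theorem mainTheorem5 {d : ℕ} (hd : 2 ≤ d) (K : RefKind) (κ : ℝ) :
    ∃ C : ℝ, 0 ≤ C ∧ ∀ α β : ℝ, 0 < α → α ≤ β → ∃ σ₀ : ℝ, 0 < σ₀ ∧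
      ∀ (Ω ΓD : Set (Eu d)), IsPolyhedralLipschitzDomain Ω →
        IsClosed ΓD → ΓD.Nonempty → ΓD ⊆ frontier Ω →
      ∀ (MH Mh : Mesh K Ω), MH.ShapeRegular κ → Mh.ShapeRegular κ →
        MH.IsRefinedBy Mh → Mh.Resolves ΓD →
      ∀ A : Eu d → Eu d →L[ℝ] Eu d, Mh.IsDiffusion A α β →
      ∀ σ : ℝ, σ₀ ≤ σ →
      ∀ f g : Eu d → ℝ, MemLp f 2 (volume.restrict Ω) → MemLp g 2 (volume.restrict Ω) →
      ∀ L : ℕ, 1 ≤ L →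
      ∀ φL : Fin MH.card → VertexIdx d K → Eu d → ℝ, AreCorrectors MH Mh ΓD A σ L φL →
      ∀ u uh uH φh φH : Eu d → ℝ,
        IsWeakSolution Ω ΓD A f u →
        IsGalerkin Mh ΓD A σ f (Mh.space 1) uh →
        IsGalerkin Mh ΓD A σ f (msSpace MH φL) uH →
        IsDualGalerkin Mh ΓD A σ g (Mh.space 1) φh →
        IsDualGalerkin Mh ΓD A σ g (msSpace MH φL) φH →
        |functional Ω g u - functional Ω g uH| ≤
          |functional Ω g u - functional Ω g uh| +
            C * (Mh.energyNorm ΓD A σ (uh - uH) * Mh.energyNorm ΓD A σ (φh - φH)) := by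
  obtain ⟨C, hC, hbound⟩ := Mesh.exists_abs_form_le hd K κ
  refine ⟨C, hC, fun α β hα hαβ => ?_⟩
  have hβ : 0 < β := hα.trans_le hαβ
  -- The threshold at which the flux terms are bounded by the energy norm independently of `α` and
  -- `β`; `C` was fixed before them.
  refine ⟨β ^ 2 / α, by positivity, ?_⟩
  intro Ω ΓD hΩ _ _ _ MH Mh _ hMh href _ A hA σ hσ f g _ _ L _ φL hφL u uh uH φh φH _ huh huH hφh hφH
  have hd0 : d ≠ 0 := by omega
  have hΩm : MeasurableSet Ω := hΩ.isOpen.measurableSet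
  have hms := msSpace_le hd0 href hφL
  have heq := functional_sub_eq_form hMh hd0 hΩm hA hms huh huH hφh hφH
  have hle := hbound α β hα hβ Ω ΓD hΩm Mh hMh A hA σ hσ (uh - uH)
    (Submodule.sub_mem _ huh.1 (hms huH.1)) (φh - φH) (Submodule.sub_mem _ hφh.1 (hms hφH.1))
  rw [← heq] at hle
  exact (abs_sub_le _ (functional Ω g uh) _).trans (by gcongr)
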